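/- Let $A\in\mathbb Z^{m\times n}$, $b\in\mathbb Z^m$, $\alpha\in\mathbb Z^n$, and let $P=\{x\in\mathbb R^n : Ax\le b\}$. Assume that $P\cap\mathbb Z^n=\{0\}$. For $I\subseteq[m]:=\{1,\dots,m\}$ let $A_I$ be the submatrix of $A$ formed by the rows indexed by $I$, and put $P_I = P\cap\ker A_I$. For $I\subseteq[m]$ with $|I|\le n-1$ such that the rows of $A_I$ are linearly independent, let $$\Delta_I=\frac1{\gcd A_I}\max\left\{\left|\det\begin{pmatrix}\alpha^\top\\ A_K\end{pmatrix}\right| : I\subseteq K\subseteq[m],\ |K|=n-1\right\},$$ where $\gcd A_I$ is the greatest common divisor of the numbers $|\det M|$ over all $\operatorname{rank}(A_I)\times\operatorname{rank}(A_I)$ submatrices $M$ of $A_I$ (so $\gcd A_\emptyset=1$), and let $$\kappa_I=\frac{1}{\Delta_I}\max_{x\in P_I}\alpha^\top x,$$ read as $0$ if $\Delta_I=0$. Then for every such $I$ the maximum of $\alpha^\top x$ over $P_I$ is attained and equals $\kappa_I\Delta_I$ (in particular it is $0$ if $\Delta_I=0$). For $d\geq 1$ let $\kappa_d$ be the maximum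 of $\kappa_I$ over all such $I$ for which $P_I$ has dimension $d$ (with $\kappa_d=0$ if there is no such $I$). Then $$\kappa_1<1,\qquad \kappa_2<1,\qquad \kappa_3<\sqrt2 .$$ -/

import Mathlib

open scoped Matrix

noncomputable section

namespace Proximity

variable {m n : ℕ}

/-- The integral matrix `A`, viewed as a real matrix. -/
def realMatrix (A : Matrix (Fin m) (Fin n) ℤ) : Matrix (Fin m) (Fin n) ℝ :=
  A.map (fun z : ℤ => (z : ℝ))

/-- An integral vector, viewed as a real vector. -/
def realVec {k : ℕ} (z : Fin k → ℤ) : Fin k → ℝ := fun i => (z i : ℝ)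

/-- The polyhedron `P(A, b) = {x ∈ ℝⁿ : A x ≤ b}`. -/
def poly (A : Matrix (Fin m) (Fin n) ℤ) (b : Fin m → ℤ) : Set (Fin n → ℝ) :=
  {x | realMatrix A *ᵥ x ≤ realVec b}

/-- The slice `P_I(A, b) = P(A, b) ∩ ker A_I`. -/
def slice (A : Matrix (Fin m) (Fin n) ℤ) (b : Fin m → ℤ) (I : Finset (Fin m)) :
    Set (Fin n → ℝ) :=
  poly A b ∩ {x | ∀ i ∈ I, (realMatrix A *ᵥ x) i = 0}

/-- The dimension of a subset of `ℝⁿ`: the dimension of its affine hull. -/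
def affDim (S : Set (Fin n → ℝ)) : ℕ := Module.finrank ℝ (affineSpan ℝ S).direction

/-- The rows of `A` indexed by `I` are linearly independent. -/
def RowsIndep (A : Matrix (Fin m) (Fin n) ℤ) (I : Finset (Fin m)) : Prop :=
  LinearIndependent ℝ (fun i : I => realMatrix A (i : Fin m))

/-- The rank of the submatrix `A_I`. -/
def rowRank (A : Matrix (Fin m) (Fin n) ℤ) (I : Finset (Fin m)) : ℕ :=
  ((realMatrix A).submatrix (fun i : I => (i : Fin m)) id).rank

/-- `gcd A_I`: the gcd of `|det M|` over all `r × r` submatrices `M` of `A_I`, `r = rank A_I`.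
The order in which the rows and columns of `M` are listed does not affect `|det M|`. -/
def gcdRows (A : Matrix (Fin m) (Fin n) ℤ) (I : Finset (Fin m)) : ℕ :=
  (Finset.univ : Finset ((Fin (rowRank A I) ↪ I) × (Fin (rowRank A I) ↪ Fin n))).gcd
    (fun p => (A.submatrix (fun i => (p.1 i : Fin m)) p.2).det.natAbs)

/-- The absolute value of the determinant of the `n × n` matrix with first row `αᵀ` followed by
the rows of `A` indexed by `K`, for `|K| = n - 1` (only such `K` are ever used). -/
def borderedMinor (A : Matrix (Fin m) (Fin n) ℤ) (α : Fin n → ℤ) (K : Finset (Fin m)) : ℕ :=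
  if h : n = K.card + 1 then
    (Matrix.det (Matrix.of fun i : Fin n =>
      (Matrix.vecCons α (fun k : Fin K.card => A (K.orderEmbOfFin rfl k)) :
        Fin (K.card + 1) → Fin n → ℤ) (Fin.cast h i))).natAbs
  else 0

/-- `Δ_I(A, α)`: the maximum of the above minors over all `K ⊇ I` with `|K| = n - 1`,
divided by `gcd A_I`. -/
def Delta (A : Matrix (Fin m) (Fin n) ℤ) (α : Fin n → ℤ) (I : Finset (Fin m)) : ℝ :=
  (((Finset.univ.filter (fun K : Finset (Fin m) => I ⊆ K ∧ K.card + 1 = n)).sup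
    (borderedMinor A α) : ℕ) : ℝ) / (gcdRows A I : ℝ)

/-- The set of values of the linear form `αᵀ x` on the slice `P_I(A, b)`. -/
def sliceValues (A : Matrix (Fin m) (Fin n) ℤ) (b : Fin m → ℤ) (α : Fin n → ℤ)
    (I : Finset (Fin m)) : Set ℝ :=
  (fun x : Fin n → ℝ => realVec α ⬝ᵥ x) '' slice A b I

/-- `κ_I(A, b, α)`: the maximum of `αᵀ x` over `P_I(A, b)` divided by `Δ_I(A, α)`
(read as `0` if `Δ_I(A, α) = 0`). -/
def kappaSlice (A : Matrix (Fin m) (Fin n) ℤ) (b : Fin m → ℤ) (α : Fin n → ℤ)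
    (I : Finset (Fin m)) : ℝ :=
  sSup (sliceValues A b α I) / Delta A α I

/-- `κ_d(A, b, α)`: the maximum of `κ_I(A, b, α)` over the (finitely many) sets `I`, with
`|I| ≤ n - 1`, of linearly independent rows for which `P_I(A, b)` has dimension `d`. -/
def kappa (A : Matrix (Fin m) (Fin n) ℤ) (b : Fin m → ℤ) (α : Fin n → ℤ) (d : ℕ) : ℝ :=
  sSup (kappaSlice A b α ''
    {I | I.card + 1 ≤ n ∧ RowsIndep A I ∧ affDim (slice A b I) = d})

end Proximity

end

/-!
Let `x` maximize `αᵀ x` over `P_I`, with `αᵀ x > 0`, and let `d` be the dimension of `P_I`. The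
linear hull of `P_I` is the kernel of `n - d` independent rows of `A`, among them `A_I`
(`exists_rows_cutting_out_slice`). Together with `α` and `d - 1` further rows `T`, these form a
nonsingular system, and `T` is chosen to maximize its determinant (`exists_maximal_rowSystem`).
On the subspace where `α` and the first `n - d` rows vanish, every row of `A` is then a combination
of the rows `T`, and the matrix `C` of coefficients has all its maximal minors in `[-1, 1]`.

Let `S` be a convex symmetric subset of `{w : |C w| < 1}`. Integral points `z` in the linear hull
of `P_I` which lie in the cylinder `|αᵀ z| ≤ αᵀ x` and differ from `(αᵀ z / αᵀ x) x` by a vector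
whose values on the rows `T` lie in `S` belong to `P` up to sign: with `s = αᵀ z / αᵀ x ∈ [0, 1]`
one has `A z < s A x + 1 ≤ b + 1`, and `A z` is integral. As `0` is the only integral point of `P`,
Minkowski's convex body theorem bounds the volume of this cylinder. This gives
`αᵀ x < 2 ^ (d - 1) / vol S * Δ_I` (`volume_mul_objective_lt`, `kappa_lt_of_volume_le`). The
inequality is strict because `αᵀ z` is integral, so that the cylinder `|αᵀ z| < ⌊αᵀ x⌋ + 1` may be
used. The factor `1 / gcd A_I` in `Δ_I` comes from writing `A_I = H B'`, where the columns of `H`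
form a basis of the lattice `A_I ℤⁿ`: then `gcd A_I` divides `det H`
(`exists_lattice_factorization`, `gcdRows_dvd_det_mul`).

For `d = 1` the body `S` is a point, and for `d = 2` it is the interval `(-1, 1)`. For `d = 3` it
is the polar of a symmetric polygon any two points of which span, with the origin, a parallelogram
of area at most one. This polar contains an octagon of area at least `2 √2`
(`two_sqrt_two_le_volume_polarBody`).

The maximum over `P_I` exists because `P` is bounded (`eq_zero_of_mulVec_nonpos`,
`isCompact_slice`).
-/

namespace Proximity

open MeasureTheory

/-! ### Area of planar polars -/

/-- The open triangle in the plane with vertices `0`, `u`, `w`. -/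
def openTriangle (u w : Fin 2 → ℝ) : Set (Fin 2 → ℝ) :=
  {y | ∃ s t : ℝ, 0 < s ∧ 0 < t ∧ s + t < 1 ∧ y = s • u + t • w}

theorem volume_standardTriangle :
    volume {y : Fin 2 → ℝ | 0 < y 0 ∧ 0 < y 1 ∧ y 0 + y 1 < 1} = ENNReal.ofReal (1 / 2) := by
  have h1 : {y : Fin 2 → ℝ | 0 < y 0 ∧ 0 < y 1 ∧ y 0 + y 1 < 1} =
      MeasurableEquiv.finTwoArrow ⁻¹'
        (regionBetween (fun _ => (0 : ℝ)) (fun x => 1 - x) (Set.Ioo 0 1)) := by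
    ext y
    change (0 < y 0 ∧ 0 < y 1 ∧ y 0 + y 1 < 1) ↔
      ((0 < y 0 ∧ y 0 < 1) ∧ (0 < y 1 ∧ y 1 < 1 - y 0))
    constructor
    · rintro ⟨h0, h1, h2⟩
      exact ⟨⟨h0, by linarith⟩, h1, by linarith⟩
    · rintro ⟨⟨h0, _⟩, h1, h2⟩
      exact ⟨h0, h1, by linarith⟩
  have hcont : Continuous (fun x : ℝ => 1 - x) := by fun_prop
  rw [h1, (volume_preserving_finTwoArrow ℝ).measure_preimage_equiv,
    Measure.volume_eq_prod, volume_regionBetween_eq_integral]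
  · congr 1
    simp only [Pi.sub_apply, sub_zero]
    rw [← integral_Ioc_eq_integral_Ioo, ← intervalIntegral.integral_of_le zero_le_one]
    rw [intervalIntegral.integral_sub (by simp) (by simp)]
    norm_num
  · exact integrableOn_const (by simp)
  · exact (hcont.integrableOn_Icc (a := 0) (b := 1)).mono_set Set.Ioo_subset_Icc_self
  · exact measurableSet_Ioo
  · intro x hx
    simp only [Set.mem_Ioo] at hx
    linarith [hx.2]

theorem openTriangle_eq_image (u w : Fin 2 → ℝ) :
    openTriangle u w = Matrix.toLin' !![u 0, w 0; u 1, w 1] ''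
      {y : Fin 2 → ℝ | 0 < y 0 ∧ 0 < y 1 ∧ y 0 + y 1 < 1} := by
  ext y
  simp only [openTriangle, Set.mem_ofPred_eq, Set.mem_image]
  constructor
  · rintro ⟨s, t, hs, ht, hst, rfl⟩
    refine ⟨![s, t], by simpa using ⟨hs, ht, hst⟩, ?_⟩
    ext i
    fin_cases i <;> simp [Matrix.mulVec, dotProduct, Fin.sum_univ_two, mul_comm]
  · rintro ⟨x, ⟨h0, h1, h2⟩, rfl⟩
    refine ⟨x 0, x 1, h0, h1, h2, ?_⟩
    ext i
    fin_cases i <;> simp [Matrix.mulVec, dotProduct, Fin.sum_univ_two, mul_comm (x _)]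

theorem volume_openTriangle (u w : Fin 2 → ℝ) :
    volume (openTriangle u w) = ENNReal.ofReal (|u 0 * w 1 - u 1 * w 0| / 2) := by
  rw [openTriangle_eq_image, Measure.addHaar_image_linearMap, volume_standardTriangle,
    ← ENNReal.ofReal_mul (abs_nonneg _), LinearMap.det_toLin', Matrix.det_fin_two_of,
    mul_one_div, mul_comm (w 0)]

theorem convex_openTriangle (u w : Fin 2 → ℝ) : Convex ℝ (openTriangle u w) := by
  rw [openTriangle_eq_image]
  refine Convex.linear_image ?_ _
  rintro x ⟨hx0, hx1, hx2⟩ y ⟨hy0, hy1, hy2⟩ a b ha hb hab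
  simp only [Set.mem_ofPred_eq, Pi.add_apply, Pi.smul_apply, smul_eq_mul]
  rcases ha.eq_or_lt with rfl | ha
  · obtain rfl : b = 1 := by linarith
    simpa using ⟨hy0, hy1, hy2⟩
  · refine ⟨by positivity, by positivity, ?_⟩
    nlinarith [mul_lt_mul_of_pos_left hx2 ha, mul_le_mul_of_nonneg_left hy2.le hb]

/-- A symmetric planar strip system: the points `y` with `|p i * y 0 + q i * y 1| < 1` for
all `i`. It is the interior of the polar of the convex hull of the points `± (p i, q i)`. -/
def polarBody {ι : Type*} (p q : ι → ℝ) : Set (Fin 2 → ℝ) :=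
  {y | ∀ i, |p i * y 0 + q i * y 1| < 1}

theorem openTriangle_subset_polarBody {ι : Type*} {p q : ι → ℝ} {u w : Fin 2 → ℝ}
    (hu : ∀ i, |p i * u 0 + q i * u 1| ≤ 1) (hw : ∀ i, |p i * w 0 + q i * w 1| ≤ 1) :
    openTriangle u w ⊆ polarBody p q := by
  rintro _ ⟨s, t, hs, ht, hst, rfl⟩ i
  simp only [Pi.add_apply, Pi.smul_apply, smul_eq_mul]
  have h1 := abs_le.1 (hu i)
  have h2 := abs_le.1 (hw i)
  rw [abs_lt]
  constructor <;> nlinarith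

theorem neg_mem_polarBody {ι : Type*} {p q : ι → ℝ} {y : Fin 2 → ℝ} (hy : y ∈ polarBody p q) :
    -y ∈ polarBody p q := by
  intro i
  have := hy i
  rw [← abs_neg] at this
  convert this using 2
  simp only [Pi.neg_apply]
  ring

theorem convex_polarBody {ι : Type*} (p q : ι → ℝ) : Convex ℝ (polarBody p q) := by
  intro x hx y hy a b ha hb hab i
  have h1 := abs_lt.1 (hx i)
  have h2 := abs_lt.1 (hy i)
  simp only [Pi.add_apply, Pi.smul_apply, smul_eq_mul]
  rcases ha.eq_or_lt with rfl | ha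
  · obtain rfl : b = 1 := by linarith
    simpa using hy i
  · rw [abs_lt]
    constructor <;> nlinarith

/-- The octagon with vertices `± e₁`, `± e₂`, `± (1/σ, 1/σ)`, `± (-q, p)`, where `σ = p + q`, has
area `2 / σ + σ`. -/
theorem octagon_area_le {p q σ : ℝ} {D : Set (Fin 2 → ℝ)} (hp : 0 ≤ p) (hq : 0 ≤ q)
    (hσ : p + q = σ) (hσ1 : 1 ≤ σ) (hD : ∀ y ∈ D, -y ∈ D)
    (h1 : openTriangle ![1, 0] ![1 / σ, 1 / σ] ⊆ D)
    (h2 : openTriangle ![1 / σ, 1 / σ] ![0, 1] ⊆ D)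
    (h3 : openTriangle ![0, 1] ![-q, p] ⊆ D)
    (h4 : openTriangle ![-q, p] ![-1, 0] ⊆ D) :
    ENNReal.ofReal (2 / σ + σ) ≤ volume D := by
  have hσ0 : 0 < σ := by linarith
  set c := 1 / σ with hc
  have hc0 : 0 < c := by positivity
  set T1 := openTriangle ![1, 0] ![c, c]
  set T2 := openTriangle ![c, c] ![0, 1]
  set T3 := openTriangle ![0, 1] ![-q, p]
  set T4 := openTriangle ![-q, p] ![-1, 0]
  have m1 : ∀ y ∈ T1, 0 < y 1 ∧ y 1 < y 0 := by
    rintro _ ⟨s, t, hs, ht, hst, rfl⟩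
    simp only [Pi.add_apply, Pi.smul_apply, smul_eq_mul, Matrix.cons_val_zero,
      Matrix.cons_val_one]
    constructor <;> nlinarith [mul_pos ht hc0]
  have m2 : ∀ y ∈ T2, 0 < y 0 ∧ y 0 < y 1 := by
    rintro _ ⟨s, t, hs, ht, hst, rfl⟩
    simp only [Pi.add_apply, Pi.smul_apply, smul_eq_mul, Matrix.cons_val_zero,
      Matrix.cons_val_one]
    constructor <;> nlinarith [mul_pos hs hc0]
  have m3 : ∀ y ∈ T3, y 0 ≤ 0 ∧ 0 < y 1 ∧ 0 ≤ p * y 0 + q * y 1 ∧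
      (0 < q → 0 < p * y 0 + q * y 1) := by
    rintro _ ⟨s, t, hs, ht, hst, rfl⟩
    simp only [Pi.add_apply, Pi.smul_apply, smul_eq_mul, Matrix.cons_val_zero,
      Matrix.cons_val_one]
    have e : p * (s * 0 + t * -q) + q * (s * 1 + t * p) = s * q := by ring
    rw [e]
    exact ⟨by nlinarith [mul_nonneg ht.le hq], by nlinarith [mul_nonneg ht.le hp],
      by positivity, fun h => by positivity⟩
  have m4 : ∀ y ∈ T4, y 0 < 0 ∧ 0 ≤ y 1 ∧ p * y 0 + q * y 1 ≤ 0 ∧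
      (0 < p → p * y 0 + q * y 1 < 0) := by
    rintro _ ⟨s, t, hs, ht, hst, rfl⟩
    simp only [Pi.add_apply, Pi.smul_apply, smul_eq_mul, Matrix.cons_val_zero,
      Matrix.cons_val_one]
    have e : p * (s * -q + t * -1) + q * (s * p + t * 0) = -(t * p) := by ring
    rw [e]
    refine ⟨by nlinarith [mul_nonneg hs.le hq], by nlinarith [mul_nonneg hs.le hp], ?_, ?_⟩
    · nlinarith [mul_nonneg ht.le hp]
    · intro h
      nlinarith [mul_pos ht h]
  have d12 : Disjoint T1 T2 := Set.disjoint_left.2 fun y h h' => by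
    linarith [m1 y h, m2 y h']
  have d34 : Disjoint T3 T4 := Set.disjoint_left.2 fun y h h' => by
    obtain ⟨-, -, a3, b3⟩ := m3 y h
    obtain ⟨-, -, a4, b4⟩ := m4 y h'
    rcases hq.eq_or_lt with h0 | h0
    · linarith [b4 (by linarith)]
    · linarith [b3 h0]
  have d1234 : Disjoint (T1 ∪ T2) (T3 ∪ T4) := Set.disjoint_left.2 fun y h h' => by
    have hpos : 0 < y 0 := by
      rcases h with h | h
      · linarith [m1 y h]
      · linarith [m2 y h]
    rcases h' with h' | h'
    · linarith [m3 y h']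
    · linarith [m4 y h']
  set U := (T1 ∪ T2) ∪ (T3 ∪ T4)
  -- When `p = 0`, the last triangle degenerates to a segment on the horizontal axis.
  have mU : ∀ y ∈ U, 0 ≤ y 1 ∧ (y 1 = 0 → y 0 < 0) := by
    rintro y ((h | h) | (h | h))
    · have := m1 y h
      exact ⟨by linarith, fun _ => by linarith⟩
    · have := m2 y h
      exact ⟨by linarith, fun _ => by linarith⟩
    · have := m3 y h
      exact ⟨by linarith, fun _ => by linarith⟩
    · have := m4 y h
      exact ⟨by linarith, fun _ => by linarith⟩
  have dU : Disjoint U (-U) := Set.disjoint_left.2 fun y h h' => by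
    obtain ⟨a, a'⟩ := mU y h
    obtain ⟨c, c'⟩ := mU _ h'
    simp only [Pi.neg_apply] at c c'
    have h0 : y 1 = 0 := by linarith
    linarith [a' h0, c' (by linarith)]
  have n1 := (convex_openTriangle ![1, 0] ![c, c]).nullMeasurableSet volume
  have n2 := (convex_openTriangle ![c, c] ![0, 1]).nullMeasurableSet volume
  have n3 := (convex_openTriangle ![0, 1] ![-q, p]).nullMeasurableSet volume
  have n4 := (convex_openTriangle ![-q, p] ![-1, 0]).nullMeasurableSet volume
  have nU : NullMeasurableSet U volume := (n1.union n2).union (n3.union n4)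
  have vU : volume U = ENNReal.ofReal (1 / σ + σ / 2) := by
    rw [measure_union₀ (n3.union n4) d1234.aedisjoint, measure_union₀ n2 d12.aedisjoint,
      measure_union₀ n4 d34.aedisjoint, volume_openTriangle, volume_openTriangle,
      volume_openTriangle, volume_openTriangle, ← ENNReal.ofReal_add (by positivity)
      (by positivity), ← ENNReal.ofReal_add (by positivity)
      (by positivity), ← ENNReal.ofReal_add (by positivity) (by positivity)]
    congr 1
    simp only [Matrix.cons_val_zero, Matrix.cons_val_one]
    simp only [one_mul, zero_mul, mul_zero, mul_one, sub_zero, zero_sub, mul_neg, neg_neg,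
      abs_of_pos hc0, abs_of_nonneg hp, abs_of_nonneg hq, ← hc]
    linarith
  have hUD : U ∪ -U ⊆ D := by
    have : U ⊆ D := Set.union_subset (Set.union_subset h1 h2) (Set.union_subset h3 h4)
    refine Set.union_subset this fun y hy => ?_
    have := hD _ (this hy)
    rwa [neg_neg] at this
  calc ENNReal.ofReal (2 / σ + σ) = volume U + volume (-U) := by
        rw [Measure.measure_neg, vU, ← ENNReal.ofReal_add (by positivity) (by positivity)]
        congr 1
        ring
    _ = volume (U ∪ -U) := (measure_union₀' nU dU.aedisjoint).symm
    _ ≤ volume D := measure_mono hUD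

/-- If the points `(p i, q i)` span, pairwise with each other and with `e₁`, `e₂`, parallelograms
of area at most one, then the polar of their symmetric convex hull has area at least `2 √2`.

Choose `(p, q)` in the first quadrant, among `e₁` and the `± (p i, q i)`, with `σ = p + q` largest.
Then `± e₁`, `± e₂`, `± (1/σ, 1/σ)` and the rotated point `± (-q, p)` lie in the polar, and their
convex hull has area `2 / σ + σ`, which is at least `2 √2` by the inequality of the means. -/
theorem two_sqrt_two_le_volume_polarBody {ι : Type*} [Finite ι] {p q : ι → ℝ}
    (hp : ∀ i, |p i| ≤ 1) (hq : ∀ i, |q i| ≤ 1) (hpq : ∀ i j, |p i * q j - p j * q i| ≤ 1) :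
    ENNReal.ofReal (2 * √2) ≤ volume (polarBody p q) := by
  obtain ⟨a, c, ha, hc, ha1, hc1, hac, hdet, hmax⟩ : ∃ a c : ℝ, 0 ≤ a ∧ 0 ≤ c ∧ a ≤ 1 ∧ c ≤ 1 ∧
      1 ≤ a + c ∧ (∀ j, |a * q j - c * p j| ≤ 1) ∧
      ∀ i, 0 ≤ p i * q i → |p i| + |q i| ≤ a + c := by
    by_cases h : ∃ i, 0 ≤ p i * q i ∧ 1 ≤ |p i| + |q i|
    · have hfin : {i | 0 ≤ p i * q i}.Finite := Set.toFinite _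
      obtain ⟨i₀, hi₀, h₀⟩ := h
      obtain ⟨i, hi, him⟩ := hfin.exists_maximalFor (fun i => |p i| + |q i|) _ ⟨i₀, hi₀⟩
      have him' : ∀ j, 0 ≤ p j * q j → |p j| + |q j| ≤ |p i| + |q i| := by
        intro j hj
        by_contra! hlt
        exact absurd (him hj hlt.le) (not_le.2 hlt)
      refine ⟨|p i|, |q i|, abs_nonneg _, abs_nonneg _, hp i, hq i, h₀.trans (him' _ hi₀), ?_,
        him'⟩
      intro j
      have hd := hpq i j
      simp only [Set.mem_ofPred_eq] at hi
      rcases mul_nonneg_iff.1 hi with ⟨h1, h2⟩ | ⟨h1, h2⟩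
      · rw [abs_of_nonneg h1, abs_of_nonneg h2, mul_comm (q i)]
        exact hd
      · rw [abs_of_nonpos h1, abs_of_nonpos h2, ← abs_neg]
        convert hd using 2
        ring
    · push Not at h
      exact ⟨1, 0, zero_le_one, le_rfl, le_rfl, zero_le_one, by simp, by simpa using hq,
        fun i hi => by simpa using (h i hi).le⟩
  set σ := a + c with hσ
  have hσ0 : 0 < σ := by linarith
  have b1 : ∀ i, |p i * (![1, 0] : Fin 2 → ℝ) 0 + q i * (![1, 0] : Fin 2 → ℝ) 1| ≤ 1 := by
    simpa using hp
  have b2 : ∀ i, |p i * (![0, 1] : Fin 2 → ℝ) 0 + q i * (![0, 1] : Fin 2 → ℝ) 1| ≤ 1 := by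
    simpa using hq
  have b5 : ∀ i, |p i * (![-1, 0] : Fin 2 → ℝ) 0 + q i * (![-1, 0] : Fin 2 → ℝ) 1| ≤ 1 := by
    simpa using hp
  have b3 : ∀ i, |p i * (![1 / σ, 1 / σ] : Fin 2 → ℝ) 0 +
      q i * (![1 / σ, 1 / σ] : Fin 2 → ℝ) 1| ≤ 1 := by
    intro i
    simp only [Matrix.cons_val_zero, Matrix.cons_val_one]
    rw [← add_mul, abs_mul, abs_of_pos (one_div_pos.2 hσ0), mul_one_div, div_le_one hσ0]
    rcases le_or_gt 0 (p i * q i) with h | h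
    · exact (abs_add_le _ _).trans (hmax i h)
    · refine le_trans ?_ hac
      have h1 := abs_le.1 (hp i)
      have h2 := abs_le.1 (hq i)
      rw [abs_le]
      rcases mul_neg_iff.1 h with ⟨h3, h4⟩ | ⟨h3, h4⟩ <;> constructor <;> linarith
  have b4 : ∀ i, |p i * (![-c, a] : Fin 2 → ℝ) 0 + q i * (![-c, a] : Fin 2 → ℝ) 1| ≤ 1 := by
    intro i
    convert hdet i using 2
    simp only [Matrix.cons_val_zero, Matrix.cons_val_one]
    ring
  refine le_trans (ENNReal.ofReal_le_ofReal ?_) (octagon_area_le ha hc hσ.symm hac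
    (fun y hy => neg_mem_polarBody hy) (openTriangle_subset_polarBody b1 b3)
    (openTriangle_subset_polarBody b3 b2) (openTriangle_subset_polarBody b2 b4)
    (openTriangle_subset_polarBody b4 b5))
  have h2 : √2 * √2 = 2 := Real.mul_self_sqrt (by norm_num)
  have : 2 / σ + σ - 2 * √2 = (σ - √2) ^ 2 / σ := by
    field_simp
    linear_combination -h2
  have h3 : 0 ≤ (σ - √2) ^ 2 / σ := by positivity
  linarith

/-! ### Minkowski's theorem for linear forms -/

/-- **Minkowski's convex body theorem** for a system of linear forms. The rows of `M` are indexed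
by an arbitrary type `ι`, and `e` only serves to make `M` square. -/
theorem exists_int_mulVec_mem {n : ℕ} {ι : Type*} [Fintype ι] (M : Matrix ι (Fin n) ℝ)
    (e : Fin n ≃ ι) (hdet : (M.submatrix e id).det ≠ 0) {S : Set (ι → ℝ)} (hconv : Convex ℝ S)
    (hsymm : ∀ y ∈ S, -y ∈ S)
    (hvol : ENNReal.ofReal (2 ^ n * |(M.submatrix e id).det|) < volume S) :
    ∃ z : Fin n → ℤ, z ≠ 0 ∧ M *ᵥ realVec z ∈ S := by
  set s : Set (Fin n → ℝ) := M.mulVecLin ⁻¹' S with hs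
  have hmp := volume_measurePreserving_piCongrLeft (fun _ : ι => ℝ) e
  have hs' : s = Matrix.toLin' (M.submatrix e id) ⁻¹'
      (MeasurableEquiv.piCongrLeft (fun _ : ι => ℝ) e ⁻¹' S) := by
    ext x
    simp only [hs, Set.mem_preimage]
    have : MeasurableEquiv.piCongrLeft (fun _ : ι => ℝ) e
        (Matrix.toLin' (M.submatrix e id) x) = M.mulVecLin x := by
      ext i
      obtain ⟨j, rfl⟩ := e.surjective i
      rw [MeasurableEquiv.coe_piCongrLeft, Equiv.piCongrLeft_apply_apply]
      simp [Matrix.mulVec, dotProduct]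
    rw [this]
  have hvs : ENNReal.ofReal (2 ^ n) < volume s := by
    rw [hs', Measure.addHaar_preimage_linearMap _ (by rwa [LinearMap.det_toLin']),
      hmp.measure_preimage_equiv, LinearMap.det_toLin']
    have hpos : 0 < |(M.submatrix e id).det| := abs_pos.2 hdet
    calc ENNReal.ofReal (2 ^ n)
        = ENNReal.ofReal |((M.submatrix e id).det)⁻¹| *
            ENNReal.ofReal (2 ^ n * |(M.submatrix e id).det|) := by
          rw [← ENNReal.ofReal_mul (abs_nonneg _), abs_inv]
          congr 1
          field_simp
      _ < _ := by
          refine ENNReal.mul_lt_mul_right ?_ ENNReal.ofReal_ne_top hvol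
          rw [Ne, ENNReal.ofReal_eq_zero, not_le, abs_inv]
          positivity
  have hfund := ZSpan.isAddFundamentalDomain' (Pi.basisFun ℝ (Fin n)) volume
  have : Countable (Submodule.span ℤ (Set.range (Pi.basisFun ℝ (Fin n)))).toAddSubgroup :=
    inferInstanceAs (Countable (Submodule.span ℤ (Set.range (Pi.basisFun ℝ (Fin n)))))
  obtain ⟨x, hx0, hx⟩ := exists_ne_zero_mem_lattice_of_measure_mul_two_pow_lt_measure hfund
    (s := s) (fun x hx => by
      simp only [hs, Set.mem_preimage, map_neg] at hx ⊢
      exact hsymm _ hx) (hconv.linear_preimage _) (by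
      rw [ZSpan.fundamentalDomain_pi_basisFun, volume_pi_pi]
      simpa [ENNReal.ofReal_pow] using hvs)
  have hmem := ((Pi.basisFun ℝ (Fin n)).mem_span_iff_repr_mem ℤ _).1 x.2
  choose z hz using hmem
  have hzx : realVec z = (x : Fin n → ℝ) := funext hz
  refine ⟨z, ?_, ?_⟩
  · rintro rfl
    apply hx0
    ext i
    rw [← hzx]
    simp [realVec]
  · rw [hzx]
    exact hx

theorem volume_sum_box {τ κ : Type*} [Fintype τ] [Fintype κ] (S : Set (τ → ℝ)) (w : κ → ℝ) :
    volume {Y : τ ⊕ κ → ℝ | (fun t => Y (Sum.inl t)) ∈ S ∧ ∀ k, |Y (Sum.inr k)| < w k} =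
      volume S * ∏ k, ENNReal.ofReal (2 * w k) := by
  have h := volume_measurePreserving_sumPiEquivProdPi (fun _ : τ ⊕ κ => ℝ)
  have h1 : {Y : τ ⊕ κ → ℝ | (fun t => Y (Sum.inl t)) ∈ S ∧ ∀ k, |Y (Sum.inr k)| < w k} =
      MeasurableEquiv.sumPiEquivProdPi (fun _ : τ ⊕ κ => ℝ) ⁻¹'
        (S ×ˢ Set.univ.pi fun k => Set.Ioo (-w k) (w k)) := by
    ext Y
    simp only [Set.mem_preimage, Set.mem_prod, Set.mem_pi, Set.mem_univ, forall_true_left,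
      Set.mem_Ioo, ← abs_lt]
    rfl
  rw [h1, h.measure_preimage_equiv, Measure.volume_eq_prod, Measure.prod_prod, volume_pi_pi]
  congr 2
  ext k
  rw [Real.volume_Ioo]
  congr 1
  ring

/-! ### Bordered minors and the gcd of maximal minors -/

/-- The row of the system named by `o`: a row of `A`, or the objective `α` for `none`. -/
def namedRow {m n : ℕ} (A : Matrix (Fin m) (Fin n) ℤ) (α : Fin n → ℤ) : Option (Fin m) → Fin n → ℤ
  | none => α
  | some k => A k

theorem natAbs_det_comp_equiv {ι : Type*} {n : ℕ} (r : ι → Fin n → ℤ) (e₁ e₂ : Fin n ≃ ι) :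
    (Matrix.of fun i => r (e₁ i)).det.natAbs = (Matrix.of fun i => r (e₂ i)).det.natAbs := by
  have h := Matrix.abs_det_submatrix_equiv_equiv (e₁.trans e₂.symm) (Equiv.refl (Fin n))
    (Matrix.of fun i => r (e₂ i))
  have h2 : (Matrix.of fun i => r (e₂ i)).submatrix (e₁.trans e₂.symm) (Equiv.refl (Fin n)) =
      Matrix.of fun i => r (e₁ i) := by
    ext i j
    simp
  rw [h2] at h
  rwa [← Int.natCast_inj, Int.natCast_natAbs, Int.natCast_natAbs]

/-- The rows of a nonsingular matrix, one of which is `α` and the others rows of `A`, form a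
bordered minor. The function `f` records which row of `A` is used, `none` standing for `α`. -/
theorem borderedMinor_eq_natAbs_det {m n : ℕ} {ι : Type*} [Fintype ι]
    (A : Matrix (Fin m) (Fin n) ℤ) (α : Fin n → ℤ) (f : ι → Option (Fin m)) (e : Fin n ≃ ι)
    {i₀ : ι} (hi₀ : f i₀ = none)
    (hdet : (Matrix.of fun i : Fin n => namedRow A α (f (e i))).det ≠ 0) {K : Finset (Fin m)}
    (hK : ∀ k, k ∈ K ↔ ∃ i, f i = some k) :
    K.card + 1 = n ∧
      borderedMinor A α K = (Matrix.of fun i : Fin n => namedRow A α (f (e i))).det.natAbs := by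
  classical
  have hinj : Function.Injective fun i => f (e i) := by
    intro i j hij
    by_contra hne
    refine hdet (Matrix.det_zero_of_row_eq hne ?_)
    simp only at hij
    ext k
    simp only [Matrix.of_apply, hij]
  have hrange : Set.range (fun i => f (e i)) = ↑K.insertNone := by
    ext o
    simp only [Set.mem_range, Finset.mem_coe]
    constructor
    · rintro ⟨i, rfl⟩
      rw [Finset.mem_insertNone]
      intro k hk
      exact (hK k).2 ⟨_, hk⟩
    · intro h
      cases o with
      | none => exact ⟨e.symm i₀, by simpa using hi₀⟩
      | some k =>
        obtain ⟨i, hi⟩ := (hK k).1 (Finset.some_mem_insertNone.1 h)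
        exact ⟨e.symm i, by simpa using hi⟩
  have hcard : K.card + 1 = n := by
    have h1 : Finset.univ.image (fun i => f (e i)) = K.insertNone := by
      rw [← Finset.coe_inj, ← hrange]
      simp
    rw [← Finset.card_insertNone, ← h1, Finset.card_image_of_injective _ hinj]
    simp
  refine ⟨hcard, ?_⟩
  set g : Fin n → Option (Fin m) := fun i =>
    (Fin.cons none (fun k => some (K.orderEmbOfFin rfl k)) :
      Fin (K.card + 1) → Option (Fin m)) (Fin.cast hcard.symm i) with hg
  have hginj : Function.Injective g := by
    refine Function.Injective.comp ?_ (Fin.cast_injective hcard.symm)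
    refine Fin.cons_injective_iff.2 ⟨by simp, ?_⟩
    exact (Option.some_injective _).comp (K.orderEmbOfFin rfl).injective
  have hgrange : Set.range g = ↑K.insertNone := by
    have : g = (Fin.cons none (fun k => some (K.orderEmbOfFin rfl k)) :
      Fin (K.card + 1) → Option (Fin m)) ∘ (finCongr hcard.symm) := rfl
    rw [this, Set.range_comp, (finCongr hcard.symm).surjective.range_eq, Set.image_univ,
      Fin.range_cons]
    ext o
    cases o with
    | none => simp
    | some k =>
      simp only [Set.mem_insert_iff, reduceCtorEq, Set.mem_range, Option.some.injEq, false_or,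
        Finset.mem_coe, Finset.some_mem_insertNone]
      rw [← Set.mem_range, Finset.range_orderEmbOfFin, Finset.mem_coe]
  have hperm := natAbs_det_comp_equiv
    (fun o : Set.range fun i => f (e i) => namedRow A α o) (Equiv.ofInjective _ hinj)
    ((Equiv.ofInjective _ hginj).trans (Equiv.setCongr (hgrange.trans hrange.symm)))
  refine Eq.trans ?_ hperm.symm
  rw [borderedMinor, dif_pos hcard.symm]
  congr 2
  ext i j
  rw [Matrix.of_apply]
  change _ = namedRow A α (g i) j
  simp only [hg]
  generalize Fin.cast hcard.symm i = l
  refine Fin.cases ?_ (fun k => ?_) l <;> simp [namedRow]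

/-- A Cauchy–Binet type divisibility: `det (A_I U)` is an integral combination of the maximal
minors of `A_I`. -/
theorem gcdRows_dvd_det_mul {m n : ℕ} (A : Matrix (Fin m) (Fin n) ℤ) (I : Finset (Fin m))
    (hI : RowsIndep A I) (U : Matrix (Fin n) I ℤ) :
    (gcdRows A I : ℤ) ∣ (A.submatrix (fun i : I => (i : Fin m)) id * U).det := by
  classical
  set B := A.submatrix (fun i : I => (i : Fin m)) id with hB
  have hrank : rowRank A I = Fintype.card I := by
    exact LinearIndependent.rank_matrix
      (M := (realMatrix A).submatrix (fun i : I => (i : Fin m)) id) hI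
  have hsum : (B * U).det = ∑ f : I → Fin n, (∏ j, U (f j) j) * (B.submatrix id f).det := by
    rw [← Matrix.det_transpose]
    have h1 : (B * U)ᵀ = fun j => ∑ k, U k j • fun i => B i k := by
      ext j i
      simp [Matrix.mul_apply, mul_comm]
    rw [h1]
    refine ((Matrix.detRowAlternating (n := I) (R := ℤ)).toMultilinearMap.map_sum
      (fun (j : I) (k : Fin n) => U k j • fun i => B i k)).trans ?_
    refine Finset.sum_congr rfl fun f _ => ?_
    refine ((Matrix.detRowAlternating (n := I) (R := ℤ)).toMultilinearMap.map_smul_univ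
      (fun j => U (f j) j) (fun j i => B i (f j))).trans ?_
    rw [smul_eq_mul, ← Matrix.det_transpose (B.submatrix id f)]
    rfl
  rw [hsum]
  refine Finset.dvd_sum fun f _ => Dvd.dvd.mul_left ?_ _
  by_cases hf : Function.Injective f
  · let e : Fin (rowRank A I) ≃ I := Fintype.equivOfCardEq (by simp [hrank])
    have h := Finset.gcd_dvd (f := fun p : (Fin (rowRank A I) ↪ I) × (Fin (rowRank A I) ↪ Fin n) =>
      (A.submatrix (fun i => (p.1 i : Fin m)) p.2).det.natAbs)
      (Finset.mem_univ (e.toEmbedding, e.toEmbedding.trans ⟨f, hf⟩))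
    have h2 : A.submatrix (fun i => ((e.toEmbedding i : I) : Fin m))
        (e.toEmbedding.trans ⟨f, hf⟩) = (B.submatrix id f).submatrix e e := by
      ext i j
      simp [hB]
    simp only [h2, Matrix.det_submatrix_equiv_self] at h
    exact Int.natCast_dvd.2 h
  · rw [Function.Injective] at hf
    push Not at hf
    obtain ⟨i, j, hij, hne⟩ := hf
    rw [Matrix.det_zero_of_column_eq hne (fun k => by simp [hij])]
    exact dvd_zero _

theorem det_mul_transpose_ne_zero {m n : ℕ} {A : Matrix (Fin m) (Fin n) ℤ} {I : Finset (Fin m)}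
    (hI : RowsIndep A I) :
    (A.submatrix (fun i : I => (i : Fin m)) id *
      (A.submatrix (fun i : I => (i : Fin m)) id)ᵀ).det ≠ 0 := by
  classical
  set B := A.submatrix (fun i : I => (i : Fin m)) id with hB
  set C : Matrix I (Fin n) ℝ := (realMatrix A).submatrix (fun i : I => (i : Fin m)) id with hC
  have hrank : (C * Cᵀ).rank = Fintype.card I := by
    rw [Matrix.rank_self_mul_transpose]
    exact LinearIndependent.rank_matrix (M := C) hI
  have hunit : IsUnit (C * Cᵀ).det := by
    rw [← Matrix.isUnit_iff_isUnit_det, ← Matrix.linearIndependent_rows_iff_isUnit,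
      linearIndependent_iff_card_eq_finrank_span, ← hrank, Matrix.rank_eq_finrank_span_row]
    rfl
  have hcast : (C * Cᵀ).det = ((B * Bᵀ).det : ℤ) := by
    rw [Int.cast_det]
    congr 1
    ext i j
    simp [Matrix.mul_apply, hB, hC, realMatrix]
  intro h
  rw [hcast, h] at hunit
  simp at hunit

theorem gcdRows_ne_zero {m n : ℕ} {A : Matrix (Fin m) (Fin n) ℤ} {I : Finset (Fin m)}
    (hI : RowsIndep A I) : gcdRows A I ≠ 0 := fun h =>
  det_mul_transpose_ne_zero hI (by
    have := gcdRows_dvd_det_mul A I hI (A.submatrix (fun i : I => (i : Fin m)) id)ᵀ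
    rwa [h, Nat.cast_zero, zero_dvd_iff] at this)

/-- The columns of an integral matrix `B` of full row rank generate a lattice. In terms of a basis
of that lattice, the columns of a matrix `H`, one has `B = H B'` with `B'` integral. -/
theorem exists_lattice_factorization {n : ℕ} {κ : Type*} [Fintype κ] [DecidableEq κ]
    (B : Matrix κ (Fin n) ℤ) (V : Matrix (Fin n) κ ℤ) {D : ℤ} (hD : D ≠ 0)
    (hBV : B * V = D • (1 : Matrix κ κ ℤ)) :
    ∃ (B' : Matrix κ (Fin n) ℤ) (U : Matrix (Fin n) κ ℤ), B = (B * U) * B' := by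
  set R := LinearMap.range B.mulVecLin with hR
  have hfr : Module.finrank ℤ R = Fintype.card κ := by
    refine le_antisymm ?_ ?_
    · simpa using Submodule.finrank_le R
    · let v : κ → R := fun k => ⟨B *ᵥ (fun j => V j k), ⟨_, rfl⟩⟩
      refine LinearIndependent.fintype_card_le_finrank (b := v) ?_
      refine LinearIndependent.of_comp R.subtype ?_
      rw [Fintype.linearIndependent_iff]
      intro g hg i
      have h := congrFun hg i
      have hv : ∀ k, (v k : κ → ℤ) i = D * (1 : Matrix κ κ ℤ) i k := by
        intro k
        have := congrFun (congrFun hBV i) k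
        rw [Matrix.smul_apply, smul_eq_mul] at this
        rw [← this]
        rfl
      simp only [Function.comp_apply, Submodule.coe_subtype, Finset.sum_apply, Pi.smul_apply,
        smul_eq_mul, hv, Pi.zero_apply, Matrix.one_apply] at h
      simpa [hD] using h
  let bR : Module.Basis κ ℤ R :=
    (Module.finBasisOfFinrankEq ℤ R hfr).reindex (Fintype.equivFin κ).symm
  have hU : ∀ k, ∃ u : Fin n → ℤ, B *ᵥ u = bR k := fun k => (bR k).2
  choose u hu using hU
  refine ⟨Matrix.of fun k j => bR.repr ⟨B *ᵥ Pi.single j 1, ⟨_, rfl⟩⟩ k,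
    Matrix.of fun j k => u k j, ?_⟩
  have hBU : ∀ i k, (B * Matrix.of fun j k => u k j) i k = (bR k : κ → ℤ) i := by
    intro i k
    rw [← hu k]
    rfl
  ext i j
  rw [Matrix.mul_apply]
  simp only [hBU]
  have h := bR.sum_repr ⟨B *ᵥ Pi.single j 1, ⟨_, rfl⟩⟩
  have h2 := congrArg (fun y : R => (y : κ → ℤ) i) h
  simp only [AddSubmonoidClass.coe_finsetSum, Finset.sum_apply, Submodule.coe_smul, Pi.smul_apply,
    smul_eq_mul, Matrix.mulVec_single_one, Matrix.col_apply] at h2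
  rw [← h2]
  refine Finset.sum_congr rfl fun k _ => ?_
  simp [mul_comm]

/-! ### Lattice points near a segment -/

/-- The names of the rows of a square system, consisting of rows `T` and `J` of `A`, the objective
`none`, and the rows in `I`. -/
def rowName {m : ℕ} {τ σ : Type*} (T : τ → Fin m) (J : σ → Fin m) (I : Finset (Fin m)) :
    τ ⊕ (Option σ ⊕ I) → Option (Fin m) :=
  Sum.elim (fun t => some (T t)) (Sum.elim (fun o => o.map J) fun i => some (i : Fin m))

/-- The square system of rows named by `rowName`. -/
def rowSystem {m n : ℕ} {τ σ : Type*} (A : Matrix (Fin m) (Fin n) ℤ) (α : Fin n → ℤ)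
    (T : τ → Fin m) (J : σ → Fin m) (I : Finset (Fin m)) :
    Matrix (τ ⊕ (Option σ ⊕ I)) (Fin n) ℤ :=
  Matrix.of fun i => namedRow A α (rowName T J I i)

theorem realMatrix_mulVec_realVec {m n : ℕ} (A : Matrix (Fin m) (Fin n) ℤ) (z : Fin n → ℤ) :
    realMatrix A *ᵥ realVec z = realVec (A *ᵥ z) := by
  ext i
  simp [realMatrix, realVec, Matrix.mulVec, dotProduct]

section

variable {m n : ℕ} {τ σ : Type*} [Fintype τ] [Fintype σ] [DecidableEq τ] [DecidableEq σ]

/-- Row reduction of `rowSystem`: the rows in `I` are replaced by the rows of `B'`, and multiples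
of the objective are subtracted from the rows `T`. -/
def reducedSystem (A : Matrix (Fin m) (Fin n) ℤ) (α : Fin n → ℤ)
    (T : τ → Fin m) (J : σ → Fin m) (I : Finset (Fin m)) (B' : Matrix I (Fin n) ℤ) (c : τ → ℝ) :
    Matrix (τ ⊕ (Option σ ⊕ I)) (Fin n) ℝ :=
  Matrix.of (Sum.elim (fun t j => (A (T t) j : ℝ) - c t * α j)
    (Sum.elim (fun o j => (namedRow A α (o.map J) j : ℝ)) fun i j => (B' i j : ℝ)))

theorem det_rowSystem_eq (A : Matrix (Fin m) (Fin n) ℤ) (α : Fin n → ℤ)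
    (T : τ → Fin m) (J : σ → Fin m) (I : Finset (Fin m)) (e : Fin n ≃ τ ⊕ (Option σ ⊕ I))
    {B' : Matrix I (Fin n) ℤ} {H : Matrix I I ℤ}
    (hB : A.submatrix (fun i : I => (i : Fin m)) id = H * B') (c : τ → ℝ) :
    (((rowSystem A α T J I).submatrix e id).det : ℝ) =
      H.det * ((reducedSystem A α T J I B' c).submatrix e id).det := by
  let X : Matrix τ (Option σ ⊕ I) ℝ :=
    Matrix.of fun t => Sum.elim (fun o => o.elim (c t) fun _ => 0) fun _ => 0
  let N : Matrix (τ ⊕ (Option σ ⊕ I)) (τ ⊕ (Option σ ⊕ I)) ℝ :=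
    Matrix.fromBlocks 1 X 0 (Matrix.fromBlocks 1 0 0 (H.map (fun z : ℤ => (z : ℝ))))
  have hN : N.det = H.det := by
    simp only [N, Matrix.det_fromBlocks_zero₂₁, Matrix.det_one, one_mul]
    exact (Int.cast_det H).symm
  have hRN : (rowSystem A α T J I).map (fun z : ℤ => (z : ℝ)) =
      N * reducedSystem A α T J I B' c := by
    ext i j
    rw [Matrix.mul_apply]
    rcases i with t | (o | i)
    · simp [N, X, rowSystem, reducedSystem, rowName, namedRow, Matrix.one_apply]
    · simp [N, rowSystem, reducedSystem, rowName, Matrix.one_apply]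
    · have := congrFun (congrFun hB i) j
      simp only [Matrix.submatrix_apply, id, Matrix.mul_apply] at this
      simp [N, rowSystem, reducedSystem, rowName, namedRow, this]
  rw [← hN, ← Matrix.det_submatrix_equiv_self e N, ← Matrix.det_mul, Matrix.submatrix_mul_equiv,
    ← hRN, Int.cast_det]
  rfl

/-- If `P` has no nonzero integral point and `x ∈ P` lies in `ker A_I ∩ ker A_J`, then `αᵀ x` is
bounded in terms of the volume of a body `S` which controls all the rows of `A` on the kernel of
`A_I`, `A_J` and `α`.

By Minkowski's theorem, if the bound failed there would be a nonzero integral `z` in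
`ker A_I ∩ ker A_J` with `|αᵀ z| ≤ αᵀ x` such that `y = z - s x`, with `s = αᵀ z / αᵀ x`, is
controlled by `S`. If `s ≥ 0`, as may be assumed by symmetry, then
`A_i z = s A_i x + A_i y < b_i + 1` for each `i`, and `z ∈ P` by integrality. The factor
`gcd A_I` is gained by replacing the rows `A_I` by generators `B'` with `A_I = H B'`. -/
theorem volume_mul_objective_lt {A : Matrix (Fin m) (Fin n) ℤ} {b : Fin m → ℤ} {α : Fin n → ℤ}
    (hb : ∀ i, 0 ≤ b i) (hP : ∀ z : Fin n → ℤ, realVec z ∈ poly A b → z = 0)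
    {I : Finset (Fin m)} (hI : RowsIndep A I) (T : τ → Fin m) (J : σ → Fin m)
    (e : Fin n ≃ τ ⊕ (Option σ ⊕ I)) (hdet : ((rowSystem A α T J I).submatrix e id).det ≠ 0)
    {x : Fin n → ℝ} (hx : x ∈ slice A b I) (hxJ : ∀ s, (realMatrix A *ᵥ x) (J s) = 0)
    (hpos : 0 < realVec α ⬝ᵥ x) {S : Set (τ → ℝ)} (hconv : Convex ℝ S)
    (hsymm : ∀ y ∈ S, -y ∈ S)
    (hS : ∀ y : Fin n → ℝ, (∀ i ∈ I, (realMatrix A *ᵥ y) i = 0) →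
      (∀ s, (realMatrix A *ᵥ y) (J s) = 0) → realVec α ⬝ᵥ y = 0 →
      (fun t => (realMatrix A *ᵥ y) (T t)) ∈ S → ∀ i, (realMatrix A *ᵥ y) i < 1)
    {v : ℝ} (hv : 0 < v) (hvol : ENNReal.ofReal v ≤ volume S) :
    v * (realVec α ⬝ᵥ x) * gcdRows A I <
      2 ^ Fintype.card τ * (((rowSystem A α T J I).submatrix e id).det.natAbs : ℝ) := by
  set a := realVec α ⬝ᵥ x with ha
  set Q := (rowSystem A α T J I).submatrix e id with hQ
  set B := A.submatrix (fun i : I => (i : Fin m)) id with hBdef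
  obtain ⟨B', U, hBU⟩ := exists_lattice_factorization B (Bᵀ * (B * Bᵀ).adjugate)
    (det_mul_transpose_ne_zero hI) (by rw [← Matrix.mul_assoc, Matrix.mul_adjugate])
  set H := B * U with hH
  have hg : (gcdRows A I : ℤ) ∣ H.det := gcdRows_dvd_det_mul A I hI U
  set c : τ → ℝ := fun t => (realMatrix A *ᵥ x) (T t) / a with hc
  set F := reducedSystem A α T J I B' c with hF
  have hdetF : (Q.det : ℝ) = H.det * (F.submatrix e id).det :=
    det_rowSystem_eq A α T J I e hBU c
  have hQ0 : (Q.det : ℝ) ≠ 0 := by exact_mod_cast hdet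
  have hH0 : (H.det : ℝ) ≠ 0 := fun h => hQ0 (by rw [hdetF, h, zero_mul])
  have hF0 : (F.submatrix e id).det ≠ 0 := fun h => hQ0 (by rw [hdetF, h, mul_zero])
  have hH0' : H.det ≠ 0 := by exact_mod_cast hH0
  have hg0 : gcdRows A I ≠ 0 := gcdRows_ne_zero hI
  have hgle : (gcdRows A I : ℝ) ≤ |(H.det : ℝ)| := by
    have := Int.le_of_dvd (abs_pos.2 hH0') ((dvd_abs _ _).2 hg)
    exact_mod_cast this
  by_contra! hcon
  -- Since `αᵀ z` is integral, `|αᵀ z| < ⌊a⌋ + 1` suffices for `|αᵀ z| ≤ a`. The slack `⌊a⌋ + 1 - a`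
  -- gives the strict volume inequality required by Minkowski's theorem.
  set k := ⌊a⌋ with hk
  have hka : a < k + 1 := Int.lt_floor_add_one a
  let w : Option σ ⊕ I → ℝ := Sum.elim (fun o => o.elim ((k : ℝ) + 1) fun _ => 1) fun _ => 1
  let S' : Set (τ ⊕ (Option σ ⊕ I) → ℝ) :=
    {Y | (fun t => Y (Sum.inl t)) ∈ S ∧ ∀ l, |Y (Sum.inr l)| < w l}
  have hvolS' : ENNReal.ofReal (2 ^ n * |(F.submatrix e id).det|) < volume S' := by
    have hcard : n = Fintype.card τ + ((Fintype.card σ + 1) + Fintype.card I) := by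
      have := Fintype.card_congr e
      simpa only [Fintype.card_sum, Fintype.card_option, Fintype.card_fin] using this
    have hw : ∏ l, ENNReal.ofReal (2 * w l) =
        ENNReal.ofReal (2 ^ ((Fintype.card σ + 1) + Fintype.card I) * (k + 1)) := by
      rw [← ENNReal.ofReal_prod_of_nonneg]
      · congr 1
        rw [Fintype.prod_sum_type, Fintype.prod_option]
        simp only [w, Sum.elim_inl, Sum.elim_inr, Option.elim_none, Option.elim_some, mul_one,
          Finset.prod_const, Finset.card_univ]
        ring
      · have : (0 : ℝ) ≤ k + 1 := by linarith
        rintro ((_ | _) | _) - <;> simp [w, this]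
    rw [volume_sum_box, hw]
    refine lt_of_lt_of_le ?_ (mul_le_mul_left hvol _)
    rw [← ENNReal.ofReal_mul hv.le, ENNReal.ofReal_lt_ofReal_iff (by
      have : (0 : ℝ) < k + 1 := by linarith
      positivity)]
    have h1 : 2 ^ Fintype.card τ * |(F.submatrix e id).det| ≤ v * a := by
      have hgpos : (0 : ℝ) < gcdRows A I := by positivity
      rw [← Int.cast_natCast (R := ℝ), Int.natCast_natAbs, Int.cast_abs, hdetF, abs_mul] at hcon
      refine le_of_mul_le_mul_right (le_trans ?_ hcon) hgpos
      have : 0 ≤ |(F.submatrix e id).det| := abs_nonneg _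
      calc 2 ^ Fintype.card τ * |(F.submatrix e id).det| * (gcdRows A I : ℝ)
          ≤ 2 ^ Fintype.card τ * |(F.submatrix e id).det| * |(H.det : ℝ)| := by gcongr
        _ = _ := by ring
    have h2 : v * a < v * (k + 1) := by gcongr
    have hpow : (2 : ℝ) ^ n =
        2 ^ Fintype.card τ * 2 ^ ((Fintype.card σ + 1) + Fintype.card I) := by
      rw [← pow_add, ← hcard]
    rw [hpow]
    have h3 : (0 : ℝ) < 2 ^ ((Fintype.card σ + 1) + Fintype.card I) := by positivity
    nlinarith [mul_lt_mul_of_pos_right (h1.trans_lt h2) h3]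
  have hconvS' : Convex ℝ S' := by
    have h1 : S' = (LinearMap.funLeft ℝ ℝ (Sum.inl : τ → τ ⊕ (Option σ ⊕ I))) ⁻¹' S ∩
        ⋂ l, (LinearMap.proj (Sum.inr l) : (τ ⊕ (Option σ ⊕ I) → ℝ) →ₗ[ℝ] ℝ) ⁻¹'
          (Set.Ioo (-w l) (w l)) := by
      ext Y
      simp only [Set.mem_inter_iff, Set.mem_iInter, Set.mem_preimage, Set.mem_Ioo, ← abs_lt]
      rfl
    rw [h1]
    exact (hconv.linear_preimage _).inter
      (convex_iInter fun l => (convex_Ioo _ _).linear_preimage _)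
  have hsymmS' : ∀ Y ∈ S', -Y ∈ S' := by
    rintro Y ⟨h1, h2⟩
    refine ⟨hsymm _ h1, fun l => ?_⟩
    rw [Pi.neg_apply, abs_neg]
    exact h2 l
  obtain ⟨z₀, hz₀, hzS₀⟩ := exists_int_mulVec_mem F e hF0 hconvS' hsymmS' hvolS'
  -- By symmetry the objective may be assumed nonnegative at the lattice point.
  obtain ⟨z, hz, hzS, hαz⟩ : ∃ z : Fin n → ℤ, z ≠ 0 ∧ F *ᵥ realVec z ∈ S' ∧ 0 ≤ α ⬝ᵥ z := by
    rcases le_total 0 (α ⬝ᵥ z₀) with h | h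
    · exact ⟨z₀, hz₀, hzS₀, h⟩
    · refine ⟨-z₀, neg_ne_zero.2 hz₀, ?_, by simpa using h⟩
      have : realVec (-z₀) = -realVec z₀ := by
        ext i
        simp [realVec]
      rw [this, Matrix.mulVec_neg]
      exact hsymmS' _ hzS₀
  have hαcast : realVec α ⬝ᵥ realVec z = ((α ⬝ᵥ z : ℤ) : ℝ) := by
    simp [realVec, dotProduct]
  have hα : α ⬝ᵥ z ≤ k := by
    have h := hzS.2 (Sum.inl none)
    have h2 : (F *ᵥ realVec z) (Sum.inr (Sum.inl none)) = ((α ⬝ᵥ z : ℤ) : ℝ) := hαcast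
    rw [h2] at h
    simp only [w, Sum.elim_inl, Option.elim_none] at h
    have h3 := (abs_lt.1 h).2
    have : α ⬝ᵥ z < k + 1 := by exact_mod_cast h3
    omega
  have hJz : ∀ s, (A *ᵥ z) (J s) = 0 := by
    intro s
    have h := hzS.2 (Sum.inl (some s))
    have h2 : (F *ᵥ realVec z) (Sum.inr (Sum.inl (some s))) = (((A *ᵥ z) (J s) : ℤ) : ℝ) := by
      have := congrFun (realMatrix_mulVec_realVec A z) (J s)
      exact this
    rw [h2] at h
    simp only [w, Sum.elim_inl, Option.elim_some] at h
    have : |(A *ᵥ z) (J s)| < 1 := by exact_mod_cast h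
    exact Int.abs_lt_one_iff.1 this
  have hIz : ∀ i ∈ I, (A *ᵥ z) i = 0 := by
    have hB'z : B' *ᵥ z = 0 := by
      ext i
      have h := hzS.2 (Sum.inr i)
      have h2 : (F *ᵥ realVec z) (Sum.inr (Sum.inr i)) = (((B' *ᵥ z) i : ℤ) : ℝ) := by
        simp [hF, reducedSystem, Matrix.mulVec, dotProduct, realVec]
      rw [h2] at h
      simp only [w, Sum.elim_inr] at h
      have : |(B' *ᵥ z) i| < 1 := by exact_mod_cast h
      exact Int.abs_lt_one_iff.1 this
    intro i hi
    have h : (B *ᵥ z) ⟨i, hi⟩ = 0 := by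
      rw [hBU, ← Matrix.mulVec_mulVec, hB'z, Matrix.mulVec_zero]
      rfl
    exact h
  have hAz := realMatrix_mulVec_realVec A z
  set s : ℝ := ((α ⬝ᵥ z : ℤ) : ℝ) / a with hs
  have hs0 : 0 ≤ s := div_nonneg (by exact_mod_cast hαz) hpos.le
  have hs1 : s ≤ 1 := by
    rw [hs, div_le_one hpos]
    exact (Int.cast_le.2 hα).trans (Int.floor_le a)
  set y := realVec z - s • x with hy
  have hAy : ∀ i, (realMatrix A *ᵥ y) i = (A *ᵥ z) i - s * (realMatrix A *ᵥ x) i := by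
    intro i
    rw [hy, Matrix.mulVec_sub, Matrix.mulVec_smul, hAz]
    rfl
  have hylt := hS y (fun i hi => by rw [hAy, hIz i hi, hx.2 i hi]; simp)
    (fun l => by rw [hAy, hJz, hxJ]; simp)
    (by
      rw [hy, dotProduct_sub, dotProduct_smul, hαcast, ← ha, smul_eq_mul, hs,
        div_mul_cancel₀ _ hpos.ne', sub_self])
    (by
      convert hzS.1 using 1
      ext t
      rw [hAy]
      have h1 : (F *ᵥ realVec z) (Sum.inl t) =
          (realMatrix A *ᵥ realVec z) (T t) - c t * (realVec α ⬝ᵥ realVec z) := by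
        simp only [hF, reducedSystem, Matrix.mulVec, dotProduct, Matrix.of_apply, Sum.elim_inl,
          sub_mul, Finset.sum_sub_distrib, Finset.mul_sum, mul_assoc]
        rfl
      rw [h1, hAz, hαcast, hc, hs]
      simp only [realVec]
      ring)
  refine hz (hP z ?_)
  change realMatrix A *ᵥ realVec z ≤ realVec b
  rw [hAz]
  intro i
  have h1 := hylt i
  rw [hAy] at h1
  have h2 : (realMatrix A *ᵥ x) i ≤ b i := hx.1 i
  have hbi : (0 : ℝ) ≤ b i := by exact_mod_cast hb i
  have h3 : (((A *ᵥ z) i : ℤ) : ℝ) < b i + 1 := by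
    nlinarith [mul_le_mul_of_nonneg_left h2 hs0, mul_le_mul_of_nonneg_right hs1 hbi]
  have h4 : (A *ᵥ z) i < b i + 1 := by exact_mod_cast h3
  have h5 : (A *ᵥ z) i ≤ b i := by omega
  simpa [realVec] using h5

end

/-! ### Recession cones and compactness -/

/-- A polyhedron whose only integral point is the origin has trivial recession cone. If `A y ≤ 0`
with `y ≠ 0`, then by Dirichlet's approximation principle some large multiple of `y` is so close
to a nonzero integral vector `z` that `A z < 1`. -/
theorem eq_zero_of_mulVec_nonpos {m n : ℕ} {A : Matrix (Fin m) (Fin n) ℤ} {b : Fin m → ℤ}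
    (hb : ∀ i, 0 ≤ b i) (hP : ∀ z : Fin n → ℤ, realVec z ∈ poly A b → z = 0) {y : Fin n → ℝ}
    (hy : ∀ i, (realMatrix A *ᵥ y) i ≤ 0) : y = 0 := by
  by_contra hne
  obtain ⟨j, hj⟩ := Function.ne_iff.1 hne
  simp only [Pi.zero_apply] at hj
  set y' : Fin n → ℝ := |y j|⁻¹ • y with hy'
  have hy'j : |y' j| = 1 := by
    simp [hy', abs_mul, hj]
  have hAy' : ∀ i, (realMatrix A *ᵥ y') i ≤ 0 := by
    intro i
    rw [hy', Matrix.mulVec_smul, Pi.smul_apply, smul_eq_mul]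
    exact mul_nonpos_of_nonneg_of_nonpos (by positivity) (hy i)
  set M : ℝ := ∑ i, ∑ l, |(A i l : ℝ)| with hM
  have hM0 : 0 ≤ M := by positivity
  -- A perturbation by less than `ε` in each coordinate changes `A y` by less than one.
  set ε : ℝ := 1 / (M + 2) with hε
  have hε0 : 0 < ε := by positivity
  have hMε : M * ε < 1 := by
    rw [hε, mul_one_div, div_lt_one (by positivity)]
    linarith
  have hε1 : ε < 1 := by
    rw [hε, div_lt_one (by positivity)]
    linarith
  let u : ℕ → Fin n → ℝ := fun k i => Int.fract (k * y' i)
  have hu : ∀ k, u k ∈ Set.Icc (0 : Fin n → ℝ) 1 := fun k =>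
    ⟨fun i => Int.fract_nonneg _, fun i => (Int.fract_lt_one _).le⟩
  obtain ⟨_, -, φ, hφ, hlim⟩ := isCompact_Icc.tendsto_subseq hu
  obtain ⟨N, hN⟩ := Metric.cauchySeq_iff'.1 hlim.cauchySeq ε hε0
  have hdist := hN (N + 1) (by omega)
  have hlt : φ N < φ (N + 1) := hφ (by omega)
  set k := φ N
  set l := φ (N + 1)
  set δ : Fin n → ℝ := u l - u k with hδ
  have hδi : ∀ i, |δ i| < ε := by
    intro i
    rw [Function.comp_apply, Function.comp_apply, dist_eq_norm] at hdist
    exact (norm_le_pi_norm (u l - u k) i).trans_lt hdist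
  set z : Fin n → ℤ := fun i => ⌊(l : ℝ) * y' i⌋ - ⌊(k : ℝ) * y' i⌋ with hz
  have hzeq : realVec z = ((l : ℝ) - k) • y' - δ := by
    ext i
    simp only [realVec, hz, hδ, u, Int.fract, Pi.sub_apply, Pi.smul_apply, smul_eq_mul]
    push_cast
    ring
  have hlk : (1 : ℝ) ≤ (l : ℝ) - k := by
    have : (k : ℝ) + 1 ≤ l := by exact_mod_cast hlt
    linarith
  have hz0 : z = 0 := by
    refine hP z fun i => ?_
    have h1 : (realMatrix A *ᵥ realVec z) i < 1 := by
      rw [hzeq, Matrix.mulVec_sub, Matrix.mulVec_smul, Pi.sub_apply, Pi.smul_apply, smul_eq_mul]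
      have h2 : |(realMatrix A *ᵥ δ) i| ≤ M * ε := by
        have h3 : (realMatrix A *ᵥ δ) i = ∑ l, (A i l : ℝ) * δ l := rfl
        rw [h3]
        calc |∑ l, (A i l : ℝ) * δ l| ≤ ∑ l, |(A i l : ℝ) * δ l| := Finset.abs_sum_le_sum_abs _ _
          _ ≤ ∑ l, |(A i l : ℝ)| * ε := by
            refine Finset.sum_le_sum fun l _ => ?_
            rw [abs_mul]
            exact mul_le_mul_of_nonneg_left (hδi l).le (abs_nonneg _)
          _ = (∑ l, |(A i l : ℝ)|) * ε := by rw [Finset.sum_mul]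
          _ ≤ M * ε := by
            refine mul_le_mul_of_nonneg_right ?_ hε0.le
            exact Finset.single_le_sum (f := fun i => ∑ l, |(A i l : ℝ)|)
              (fun i _ => by positivity) (Finset.mem_univ i)
      have h3 := (abs_le.1 h2).1
      nlinarith [hAy' i]
    rw [realMatrix_mulVec_realVec] at h1 ⊢
    simp only [realVec] at h1 ⊢
    have h4 : (A *ᵥ z) i < 1 := by exact_mod_cast h1
    have h5 : (A *ᵥ z) i ≤ b i := by have := hb i; omega
    exact_mod_cast h5
  have hzj := congrFun hzeq j
  rw [hz0] at hzj
  simp only [realVec, Pi.zero_apply, Int.cast_zero, Pi.sub_apply, Pi.smul_apply,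
    smul_eq_mul] at hzj
  have h6 : ((l : ℝ) - k) * y' j = δ j := by linarith
  have h7 : |((l : ℝ) - k) * y' j| = (l : ℝ) - k := by
    rw [abs_mul, hy'j, mul_one, abs_of_nonneg (by linarith)]
  rw [h6] at h7
  linarith [hδi j]

theorem isCompact_slice {m n : ℕ} {A : Matrix (Fin m) (Fin n) ℤ} {b : Fin m → ℤ}
    (hb : ∀ i, 0 ≤ b i) (hrec : ∀ y : Fin n → ℝ, (∀ i, (realMatrix A *ᵥ y) i ≤ 0) → y = 0)
    (I : Finset (Fin m)) : IsCompact (slice A b I) := by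
  have hcont : ∀ i, Continuous fun x : Fin n → ℝ => (realMatrix A *ᵥ x) i := fun i => by
    unfold Matrix.mulVec dotProduct
    fun_prop
  have hclosed : IsClosed (slice A b I) := by
    have : slice A b I = (⋂ i, {x | (realMatrix A *ᵥ x) i ≤ b i}) ∩
        ⋂ i ∈ I, {x | (realMatrix A *ᵥ x) i = 0} := by
      ext x
      simp only [slice, poly, Set.mem_inter_iff, Set.mem_iInter]
      rfl
    rw [this]
    exact (isClosed_iInter fun i => isClosed_le (hcont i) continuous_const).inter
      (isClosed_biInter fun i _ => isClosed_eq (hcont i) continuous_const)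
  -- The total positive part of `A y` is bounded below on the unit sphere, and above on `P`.
  let f : (Fin n → ℝ) → ℝ := fun y => ∑ i, max ((realMatrix A *ᵥ y) i) 0
  have hf : Continuous f := continuous_finsetSum _ fun i _ => (hcont i).max continuous_const
  have hfpos : ∀ y ∈ Metric.sphere (0 : Fin n → ℝ) 1, 0 < f y := by
    intro y hy
    have h0 : 0 ≤ f y := Finset.sum_nonneg fun i _ => le_max_right _ _
    refine lt_of_le_of_ne h0 fun h => ?_
    have h1 := (Finset.sum_eq_zero_iff_of_nonneg (fun i _ => le_max_right _ _)).1 h.symm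
    have h2 := hrec y fun i => by
      have := h1 i (Finset.mem_univ i)
      rw [← this]
      exact le_max_left _ _
    rw [h2] at hy
    simp at hy
  obtain ⟨δ, hδ0, hδ⟩ := (isCompact_sphere (0 : Fin n → ℝ) 1).exists_forall_le' hf.continuousOn
    hfpos
  refine Metric.isCompact_of_isClosed_isBounded hclosed
    (isBounded_iff_forall_norm_le.2 ⟨(∑ i, (b i : ℝ)) / δ, fun x hx => ?_⟩)
  rw [le_div_iff₀ hδ0]
  have hbx : f x ≤ ∑ i, (b i : ℝ) :=
    Finset.sum_le_sum fun i _ => max_le (hx.1 i) (by exact_mod_cast hb i)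
  rcases eq_or_ne x 0 with rfl | hx0
  · rw [norm_zero, zero_mul]
    exact Finset.sum_nonneg fun i _ => by exact_mod_cast hb i
  · refine le_trans ?_ hbx
    have hn : 0 < ‖x‖ := norm_pos_iff.2 hx0
    have h1 := hδ (‖x‖⁻¹ • x) (by simp [norm_smul, hn.ne'])
    have h2 : f (‖x‖⁻¹ • x) = ‖x‖⁻¹ * f x := by
      simp only [f, Finset.mul_sum]
      refine Finset.sum_congr rfl fun i _ => ?_
      rw [Matrix.mulVec_smul, Pi.smul_apply, smul_eq_mul,
        mul_max_of_nonneg _ _ (inv_nonneg.2 hn.le), mul_zero]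
    rw [h2, inv_mul_eq_div, le_div_iff₀ hn] at h1
    linarith

theorem zero_mem_slice {m n : ℕ} {A : Matrix (Fin m) (Fin n) ℤ} {b : Fin m → ℤ}
    (hb : ∀ i, 0 ≤ b i) (I : Finset (Fin m)) : (0 : Fin n → ℝ) ∈ slice A b I := by
  refine ⟨?_, fun i _ => by simp⟩
  change realMatrix A *ᵥ 0 ≤ realVec b
  rw [Matrix.mulVec_zero]
  intro i
  simpa [realVec] using hb i

theorem span_rows_eq_top {m n : ℕ} {A : Matrix (Fin m) (Fin n) ℤ}
    (hker : ∀ y : Fin n → ℝ, realMatrix A *ᵥ y = 0 → y = 0) :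
    Submodule.span ℝ (Set.range fun i => realMatrix A i) = ⊤ := by
  apply Submodule.eq_top_of_finrank_eq
  have h := (realMatrix A).rank_eq_finrank_span_row
  have hinj : LinearIndependent ℝ (realMatrix A)ᵀ := by
    refine Matrix.mulVec_injective_iff.1 ?_
    intro x y hxy
    have := hker (x - y) (by rw [Matrix.mulVec_sub]; exact sub_eq_zero.2 hxy)
    exact sub_eq_zero.1 this
  have h2 := LinearIndependent.rank_matrix (M := (realMatrix A)ᵀ) hinj
  rw [Matrix.rank_transpose] at h2
  change Module.finrank ℝ (Submodule.span ℝ (Set.range (realMatrix A).row)) = _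
  rw [← h, h2]
  simp

/-- Independent rows `A_I` whose span does not contain `α` extend, together with `α`, to a basis
consisting of `α` and rows of `A`. -/
theorem exists_linearIndependent_namedRow {m n : ℕ} {A : Matrix (Fin m) (Fin n) ℤ}
    (hker : ∀ y : Fin n → ℝ, realMatrix A *ᵥ y = 0 → y = 0) {α : Fin n → ℤ}
    {I : Finset (Fin m)} (hI : RowsIndep A I)
    (hα : realVec α ∉ Submodule.span ℝ ((fun i => realMatrix A i) '' (I : Set (Fin m)))) :
    ∃ K : Finset (Fin m), I ⊆ K ∧ K.card + 1 = n ∧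
      LinearIndependent ℝ (fun o : K.insertNone => realVec (namedRow A α o)) := by
  classical
  let v : Option (Fin m) → Fin n → ℝ := fun o => realVec (namedRow A α o)
  have hv : ∀ k, v (some k) = realMatrix A k := fun k => rfl
  have hs : LinearIndepOn ℝ v (insert none (some '' (I : Set (Fin m)))) := by
    rw [linearIndepOn_insert (by simp)]
    constructor
    · exact LinearIndepOn.image_of_comp some v hI
    · rw [Set.image_image]
      exact hα
  obtain ⟨t, -, hst, hspan, ht⟩ := exists_linearIndepOn_extension hs (Set.subset_univ _)
  have htop : Submodule.span ℝ (v '' t) = ⊤ := by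
    rw [eq_top_iff, ← span_rows_eq_top hker]
    refine Submodule.span_le.2 ?_
    rintro _ ⟨i, rfl⟩
    exact hspan ⟨some i, Set.mem_univ _, rfl⟩
  set K : Finset (Fin m) := Finset.univ.filter fun k => some k ∈ t with hK
  have hKt : (K.insertNone : Set (Option (Fin m))) = t := by
    ext o
    rw [Finset.mem_coe, Finset.mem_insertNone]
    cases o with
    | none => simpa using hst (Set.mem_insert _ _)
    | some k => simp [hK]
  have hLI : LinearIndependent ℝ (fun o : K.insertNone => realVec (namedRow A α o)) := by
    have h : LinearIndepOn ℝ v (K.insertNone : Set (Option (Fin m))) := by rwa [hKt]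
    exact h
  have hcard : K.card + 1 = n := by
    have h1 := Module.finrank_eq_card_basis (Module.Basis.mk hLI (by
      rw [← htop, ← hKt, Set.image_eq_range]
      rfl))
    rw [Module.finrank_fin_fun, Fintype.card_coe, Finset.card_insertNone] at h1
    exact h1.symm
  refine ⟨K, ?_, hcard, hLI⟩
  · intro i hi
    rw [hK, Finset.mem_filter]
    exact ⟨Finset.mem_univ _, hst (Set.mem_insert_of_mem _ ⟨i, hi, rfl⟩)⟩

/-! ### Linear hulls of slices and determinant-maximal systems of rows -/

/-- The linear hull of `P_I` is cut out by rows of `A`: a point in the relative interior of `P_I`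
satisfies strictly every inequality whose row does not vanish on `P_I`. -/
theorem exists_rows_cutting_out_slice {m n : ℕ} {A : Matrix (Fin m) (Fin n) ℤ} {b : Fin m → ℤ}
    (hb : ∀ i, 0 ≤ b i) {I : Finset (Fin m)} (hI : RowsIndep A I) :
    ∃ I' : Finset (Fin m), I ⊆ I' ∧ RowsIndep A I' ∧ I'.card + affDim (slice A b I) = n ∧
      ∀ x ∈ slice A b I, ∀ i ∈ I', (realMatrix A *ᵥ x) i = 0 := by
  classical
  have h0 := zero_mem_slice (A := A) hb I
  have hdir : (affineSpan ℝ (slice A b I)).direction = Submodule.span ℝ (slice A b I) := by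
    rw [direction_affineSpan, vectorSpan_eq_span_vsub_set_right ℝ h0]
    simp
  set E : Set (Fin m) := {i | ∀ x ∈ slice A b I, (realMatrix A *ᵥ x) i = 0} with hE
  have hIE : (I : Set (Fin m)) ⊆ E := fun i hi x hx => hx.2 i hi
  obtain ⟨t, htE, hIt, hspan, ht⟩ := exists_linearIndepOn_extension
    (K := ℝ) (v := fun i => realMatrix A i) (s := (I : Set (Fin m))) hI hIE
  set I' : Finset (Fin m) := t.toFinite.toFinset with hI'
  have hI't : (I' : Set (Fin m)) = t := by simp [hI']
  have hI'ind : RowsIndep A I' := by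
    have h : LinearIndepOn ℝ (fun i => realMatrix A i) (I' : Set (Fin m)) := by rwa [hI't]
    exact h
  have hslice : ∀ x ∈ slice A b I, ∀ i ∈ I', (realMatrix A *ᵥ x) i = 0 := by
    intro x hx i hi
    rw [← Finset.mem_coe, hI't] at hi
    exact htE hi x hx
  set C : Matrix I' (Fin n) ℝ := (realMatrix A).submatrix (fun i : I' => (i : Fin m)) id with hC
  -- A kernel vector of the rows `I'` is annihilated by all the rows in `E`.
  have hkerE : ∀ y, C *ᵥ y = 0 → ∀ i ∈ E, (realMatrix A *ᵥ y) i = 0 := by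
    intro y hy i hi
    have hle : Submodule.span ℝ ((fun i => realMatrix A i) '' t) ≤
        LinearMap.ker ((dotProductBilin ℝ ℝ).flip y) := by
      refine Submodule.span_le.2 ?_
      rintro _ ⟨k, hk, rfl⟩
      have hk' : k ∈ I' := by rwa [← Finset.mem_coe, hI't]
      exact congrFun hy ⟨k, hk'⟩
    exact hle (hspan ⟨i, hi, rfl⟩)
  have hex : ∀ i, ∃ p ∈ slice A b I, i ∉ E → (realMatrix A *ᵥ p) i < b i := by
    intro i
    by_contra! hcon
    have hi : i ∉ E := (hcon 0 h0).1
    have hbi : (b i : ℝ) ≤ 0 := by simpa using (hcon 0 h0).2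
    refine hi fun x hx => le_antisymm ?_ ?_
    · exact (hx.1 i).trans hbi
    · have : (0 : ℝ) ≤ b i := by exact_mod_cast hb i
      exact this.trans (hcon x hx).2
  choose p hp hpi using hex
  set x₀ : Fin n → ℝ := ((m : ℝ) + 1)⁻¹ • ∑ i, p i with hx₀
  have hm : (0 : ℝ) < (m : ℝ) + 1 := by positivity
  have hAx₀ : ∀ i, (realMatrix A *ᵥ x₀) i = ((m : ℝ) + 1)⁻¹ * ∑ j, (realMatrix A *ᵥ p j) i := by
    intro i
    rw [hx₀, Matrix.mulVec_smul, Matrix.mulVec_sum, Pi.smul_apply, smul_eq_mul, Finset.sum_apply]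
  have hx₀E : ∀ i ∈ E, (realMatrix A *ᵥ x₀) i = 0 := by
    intro i hi
    rw [hAx₀, Finset.sum_eq_zero fun j _ => hi _ (hp j), mul_zero]
  have hx₀lt : ∀ i, i ∉ E → (realMatrix A *ᵥ x₀) i < b i := by
    intro i hi
    have hbi : (0 : ℝ) ≤ b i := by exact_mod_cast hb i
    rw [hAx₀, inv_mul_lt_iff₀ hm]
    have h1 : ∑ j, (realMatrix A *ᵥ p j) i < ∑ _j : Fin m, (b i : ℝ) :=
      Finset.sum_lt_sum (fun j _ => (hp j).1 i) ⟨i, Finset.mem_univ _, hpi i hi⟩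
    simp only [Finset.sum_const, Finset.card_univ, Fintype.card_fin, nsmul_eq_mul] at h1
    linarith
  have hmemE : ∀ y, (∀ i ∈ E, (realMatrix A *ᵥ y) i = 0) →
      (∀ i, i ∉ E → (realMatrix A *ᵥ y) i ≤ b i) → y ∈ slice A b I := by
    intro y hy1 hy2
    refine ⟨fun i => ?_, fun i hi => hy1 i (hIE hi)⟩
    by_cases hi : i ∈ E
    · have : (0 : ℝ) ≤ b i := by exact_mod_cast hb i
      rw [hy1 i hi]
      exact this
    · exact hy2 i hi
  have hker : LinearMap.ker C.mulVecLin = Submodule.span ℝ (slice A b I) := by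
    refine le_antisymm ?_ (Submodule.span_le.2 ?_)
    · intro y hy
      have hyE := hkerE y hy
      have hev : ∀ᶠ ε : ℝ in nhds 0, ∀ i, i ∉ E → (realMatrix A *ᵥ (x₀ + ε • y)) i < b i := by
        rw [Filter.eventually_all]
        intro i
        by_cases hi : i ∈ E
        · exact Filter.Eventually.of_forall fun _ h => absurd hi h
        · have hc : ContinuousAt (fun ε : ℝ => (realMatrix A *ᵥ (x₀ + ε • y)) i) 0 := by
            simp only [Matrix.mulVec_add, Matrix.mulVec_smul, Pi.add_apply, Pi.smul_apply,
              smul_eq_mul]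
            fun_prop
          have := hc.eventually_lt (continuousAt_const (y := (b i : ℝ)))
            (by simpa using hx₀lt i hi)
          exact this.mono fun _ h _ => h
      obtain ⟨ε, hε, hε0⟩ := ((hev.filter_mono nhdsWithin_le_nhds).and
        (self_mem_nhdsWithin (a := (0 : ℝ)) (s := Set.Ioi 0))).exists
      have hε0 : (0 : ℝ) < ε := hε0
      have h1 : x₀ + ε • y ∈ slice A b I := hmemE _ (fun i hi => by
        rw [Matrix.mulVec_add, Pi.add_apply, hx₀E i hi, Matrix.mulVec_smul, Pi.smul_apply,
          hyE i hi, smul_zero, add_zero]) fun i hi => (hε i hi).le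
      have h2 : x₀ ∈ slice A b I := hmemE _ hx₀E fun i hi => (hx₀lt i hi).le
      have h3 : y = ε⁻¹ • ((x₀ + ε • y) - x₀) := by
        rw [add_sub_cancel_left, inv_smul_smul₀ hε0.ne']
      rw [h3]
      exact Submodule.smul_mem _ _ (Submodule.sub_mem _ (Submodule.subset_span h1)
        (Submodule.subset_span h2))
    · intro x hx
      ext i
      exact hslice x hx i i.2
  refine ⟨I', ?_, hI'ind, ?_, hslice⟩
  · rw [← Finset.coe_subset, hI't]
    exact hIt
  · have hrank : Module.finrank ℝ (LinearMap.range C.mulVecLin) = I'.card := by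
      have := LinearIndependent.rank_matrix (M := C) hI'ind
      rwa [Fintype.card_coe] at this
    have h1 := LinearMap.finrank_range_add_finrank_ker C.mulVecLin
    rw [hrank, hker, Module.finrank_fin_fun] at h1
    rw [affDim, hdir, h1]

theorem det_ne_zero_of_linearIndependent {n : ℕ} {r : Fin n → Fin n → ℤ}
    (h : LinearIndependent ℝ fun i => realVec (r i)) : (Matrix.of r).det ≠ 0 := by
  have h1 : LinearIndependent ℝ ((Matrix.of r).map (fun z : ℤ => (z : ℝ))).row := h
  rw [Matrix.linearIndependent_rows_iff_isUnit, Matrix.isUnit_iff_isUnit_det] at h1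
  intro h2
  have h3 : ((Matrix.of r).map (fun z : ℤ => (z : ℝ))).det = ((Matrix.of r).det : ℤ) :=
    (Int.cast_det _).symm
  rw [h3, h2] at h1
  simp at h1

/-- Choose the rows `T` so that the determinant of `rowSystem` is largest in absolute value. By
Cramer's rule, the coordinates `C` of the rows of `A` with respect to the rows `T`, modulo the
other rows of the system, then have all their maximal minors in `[-1, 1]`. -/
theorem exists_maximal_rowSystem {m n d : ℕ} {A : Matrix (Fin m) (Fin n) ℤ} {α : Fin n → ℤ}
    (hker : ∀ y : Fin n → ℝ, realMatrix A *ᵥ y = 0 → y = 0)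
    {I I' : Finset (Fin m)} (hII' : I ⊆ I') (hI' : RowsIndep A I') (hcard : I'.card + (d + 1) = n)
    (hα : realVec α ∉ Submodule.span ℝ ((fun i => realMatrix A i) '' (I' : Set (Fin m)))) :
    ∃ (T : Fin d → Fin m) (e : Fin n ≃ Fin d ⊕ (Option ↥(I' \ I) ⊕ I))
      (C : Matrix (Fin m) (Fin d) ℝ),
      ((rowSystem A α T (fun i : ↥(I' \ I) => (i : Fin m)) I).submatrix e id).det ≠ 0 ∧
      (∀ y : Fin n → ℝ, (∀ i ∈ I', (realMatrix A *ᵥ y) i = 0) → realVec α ⬝ᵥ y = 0 →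
        ∀ i, (realMatrix A *ᵥ y) i = ∑ t, C i t * (realMatrix A *ᵥ y) (T t)) ∧
      (∀ T' : Fin d → Fin m, |(C.submatrix T' id).det| ≤ 1) ∧
      C.submatrix T id = 1 := by
  classical
  set J : ↥(I' \ I) → Fin m := fun i => (i : Fin m) with hJ
  have hcardι : Fintype.card (Fin n) = Fintype.card (Fin d ⊕ (Option ↥(I' \ I) ⊕ I)) := by
    have h1 := Finset.card_sdiff_add_card_eq_card hII'
    simp only [Fintype.card_fin, Fintype.card_sum, Fintype.card_option, Fintype.card_coe]
    omega
  let e : Fin n ≃ Fin d ⊕ (Option ↥(I' \ I) ⊕ I) := Fintype.equivOfCardEq hcardι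
  obtain ⟨K, hI'K, hKn, hLI⟩ := exists_linearIndependent_namedRow hker hI' hα
  have hKcard : (K \ I').card = d := by
    have h1 := Finset.card_sdiff_add_card_eq_card hI'K
    omega
  let T₀ : Fin d → Fin m := (K \ I').orderEmbOfFin hKcard
  have hT₀ : ∀ t, T₀ t ∈ K \ I' := fun t => Finset.orderEmbOfFin_mem _ _ t
  have hdet₀ : ((rowSystem A α T₀ J I).submatrix e id).det ≠ 0 := by
    have hmem : ∀ i, rowName T₀ J I i ∈ K.insertNone := by
      rintro (t | (_ | i) | i)
      · exact Finset.some_mem_insertNone.2 (Finset.mem_sdiff.1 (hT₀ t)).1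
      · exact Finset.none_mem_insertNone
      · exact Finset.some_mem_insertNone.2 (hI'K (Finset.mem_sdiff.1 i.2).1)
      · exact Finset.some_mem_insertNone.2 (hI'K (hII' i.2))
    have hinj : Function.Injective (rowName T₀ J I) := by
      have h1 : ∀ t (i : ↥(I' \ I)), T₀ t ≠ i := fun t i h =>
        (Finset.mem_sdiff.1 (hT₀ t)).2 (h ▸ (Finset.mem_sdiff.1 i.2).1)
      have h2 : ∀ t (i : I), T₀ t ≠ i := fun t i h =>
        (Finset.mem_sdiff.1 (hT₀ t)).2 (h ▸ hII' i.2)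
      have h3 : ∀ (i : ↥(I' \ I)) (k : I), (i : Fin m) ≠ k := fun i k h =>
        (Finset.mem_sdiff.1 i.2).2 (h ▸ k.2)
      rintro (t | (_ | i) | i) (t' | (_ | i') | i') h
      all_goals simp only [rowName, Sum.elim_inl, Sum.elim_inr, Option.map_none, Option.map_some,
        Option.some.injEq, reduceCtorEq, hJ] at h
      · rw [(Finset.orderEmbOfFin (K \ I') hKcard).injective h]
      · exact absurd h (h1 _ _)
      · exact absurd h (h2 _ _)
      · rfl
      · exact absurd h.symm (h1 _ _)
      · rw [Subtype.ext h]
      · exact absurd h (h3 _ _)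
      · exact absurd h.symm (h2 _ _)
      · exact absurd h.symm (h3 _ _)
      · rw [Subtype.ext h]
    refine det_ne_zero_of_linearIndependent (r := fun i => namedRow A α (rowName T₀ J I (e i))) ?_
    exact hLI.comp (fun i => ⟨rowName T₀ J I (e i), hmem _⟩) fun i k h =>
      e.injective (hinj (Subtype.ext_iff.1 h))
  have : Nonempty (Fin d → Fin m) := ⟨T₀⟩
  obtain ⟨T, hT⟩ := Finite.exists_max fun T : Fin d → Fin m =>
    |((rowSystem A α T J I).submatrix e id).det|
  have hdet : ((rowSystem A α T J I).submatrix e id).det ≠ 0 := by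
    have h1 := abs_pos.2 hdet₀
    exact abs_pos.1 (h1.trans_le (hT T₀))
  set R : Matrix (Fin d ⊕ (Option ↥(I' \ I) ⊕ I)) (Fin n) ℝ :=
    (rowSystem A α T J I).map (fun z : ℤ => (z : ℝ)) with hR
  have hdetcast : ∀ T : Fin d → Fin m,
      (((rowSystem A α T J I).map (fun z : ℤ => (z : ℝ))).submatrix e id).det =
        (((rowSystem A α T J I).submatrix e id).det : ℤ) := fun T => (Int.cast_det _).symm
  have hunit : IsUnit (R.submatrix e id).det := by
    rw [hR, hdetcast, isUnit_iff_ne_zero]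
    exact_mod_cast hdet
  set V : Matrix (Fin n) (Fin d ⊕ (Option ↥(I' \ I) ⊕ I)) ℝ :=
    ((R.submatrix e id)⁻¹).submatrix id e.symm with hV
  have hVR : V * R = 1 := by
    have h1 := Matrix.nonsing_inv_mul _ hunit
    rw [← h1]
    ext i j
    simp only [hV, Matrix.mul_apply, Matrix.submatrix_apply, id]
    rw [← e.sum_comp]
    simp
  have hRV : R * V = 1 := by
    have h1 := Matrix.mul_nonsing_inv _ hunit
    ext i j
    have h2 := congrFun (congrFun h1 (e.symm i)) (e.symm j)
    simp only [Matrix.mul_apply, Matrix.submatrix_apply, id, Equiv.apply_symm_apply,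
      Matrix.one_apply, EmbeddingLike.apply_eq_iff_eq] at h2 ⊢
    exact h2
  set W := realMatrix A * V with hW
  have hWR : W * R = realMatrix A := by
    rw [hW, Matrix.mul_assoc, hVR, Matrix.mul_one]
  refine ⟨T, e, W.submatrix id Sum.inl, hdet, ?_, ?_, ?_⟩
  · intro y hy hαy i
    have h1 : (realMatrix A *ᵥ y) i = (W *ᵥ (R *ᵥ y)) i := by
      rw [Matrix.mulVec_mulVec, hWR]
    have h2 : ∀ t, (R *ᵥ y) (Sum.inl t) = (realMatrix A *ᵥ y) (T t) := fun t => rfl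
    have h3 : ∀ k, (R *ᵥ y) (Sum.inr k) = 0 := by
      rintro ((_ | k) | k)
      · exact hαy
      · exact hy k (Finset.mem_sdiff.1 k.2).1
      · exact hy k (hII' k.2)
    rw [h1, Matrix.mulVec, dotProduct, Fintype.sum_sum_type]
    simp only [h2, h3, mul_zero, Finset.sum_const_zero, add_zero]
    rfl
  · intro T'
    have hN : (rowSystem A α T' J I).map (fun z : ℤ => (z : ℝ)) =
        Matrix.fromBlocks ((W.submatrix id Sum.inl).submatrix T' id)
          ((W.submatrix id Sum.inr).submatrix T' id) 0 1 * R := by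
      ext i j
      rcases i with t | k
      · have h1 := congrFun (congrFun hWR (T' t)) j
        rw [Matrix.mul_apply, Fintype.sum_sum_type] at h1 ⊢
        exact h1.symm
      · rw [Matrix.mul_apply, Fintype.sum_sum_type]
        simp [Matrix.one_apply, hR, rowSystem, rowName]
    have h1 : ((((rowSystem A α T' J I).submatrix e id).det : ℤ) : ℝ) =
        ((W.submatrix id Sum.inl).submatrix T' id).det *
          (((rowSystem A α T J I).submatrix e id).det : ℤ) := by
      rw [← hdetcast, ← hdetcast, hN, ← Matrix.submatrix_mul_equiv _ _ e e id, Matrix.det_mul,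
        Matrix.det_submatrix_equiv_self, Matrix.det_fromBlocks_zero₂₁, Matrix.det_one, mul_one]
    have h2 : |((((rowSystem A α T' J I).submatrix e id).det : ℤ) : ℝ)| ≤
        |((((rowSystem A α T J I).submatrix e id).det : ℤ) : ℝ)| := by exact_mod_cast hT T'
    have h3 : (0 : ℝ) < |((((rowSystem A α T J I).submatrix e id).det : ℤ) : ℝ)| := by
      rw [abs_pos]
      exact_mod_cast hdet
    rw [h1, abs_mul] at h2
    exact le_of_mul_le_mul_right (by rwa [one_mul]) h3
  · ext s t
    have h1 := congrFun (congrFun hRV (Sum.inl s)) (Sum.inl t)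
    rw [Matrix.mul_apply] at h1
    simp only [Matrix.one_apply, Sum.inl.injEq] at h1
    rw [Matrix.one_apply, ← h1]
    rfl

/-! ### Bounds on the normalized objective -/

theorem objective_notMem_span {m n : ℕ} {A : Matrix (Fin m) (Fin n) ℤ} {α : Fin n → ℤ}
    {I : Finset (Fin m)} {x : Fin n → ℝ} (hx : ∀ i ∈ I, (realMatrix A *ᵥ x) i = 0)
    (hpos : realVec α ⬝ᵥ x ≠ 0) :
    realVec α ∉ Submodule.span ℝ ((fun i => realMatrix A i) '' (I : Set (Fin m))) := by
  intro hα
  have hle : Submodule.span ℝ ((fun i => realMatrix A i) '' (I : Set (Fin m))) ≤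
      LinearMap.ker ((dotProductBilin ℝ ℝ).flip x) := by
    refine Submodule.span_le.2 ?_
    rintro _ ⟨k, hk, rfl⟩
    exact hx k hk
  exact hpos (hle hα)

theorem borderedMinor_le_Delta_mul {m n : ℕ} {A : Matrix (Fin m) (Fin n) ℤ} {α : Fin n → ℤ}
    {I K : Finset (Fin m)} (hI : RowsIndep A I) (hIK : I ⊆ K) (hK : K.card + 1 = n) :
    (borderedMinor A α K : ℝ) ≤ Delta A α I * gcdRows A I := by
  have hg : (gcdRows A I : ℝ) ≠ 0 := by exact_mod_cast gcdRows_ne_zero hI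
  rw [Delta, div_mul_cancel₀ _ hg, Nat.cast_le]
  exact Finset.le_sup (f := borderedMinor A α) (by simpa using ⟨hIK, hK⟩)

theorem Delta_nonneg {m n : ℕ} (A : Matrix (Fin m) (Fin n) ℤ) (α : Fin n → ℤ)
    (I : Finset (Fin m)) : 0 ≤ Delta A α I := by
  unfold Delta
  positivity

/-- If `Δ_I = 0`, then `α` lies in the span of the rows `A_I`, for otherwise `α` and `A_I` would
extend by rows of `A` to a basis, giving a nonzero bordered minor. -/
theorem objective_eq_zero_of_Delta_eq_zero {m n : ℕ} {A : Matrix (Fin m) (Fin n) ℤ}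
    {α : Fin n → ℤ} (hker : ∀ y : Fin n → ℝ, realMatrix A *ᵥ y = 0 → y = 0)
    {I : Finset (Fin m)} (hI : RowsIndep A I) (hΔ : Delta A α I = 0) {x : Fin n → ℝ}
    (hx : ∀ i ∈ I, (realMatrix A *ᵥ x) i = 0) : realVec α ⬝ᵥ x = 0 := by
  by_contra hne
  obtain ⟨K, hIK, hK, hLI⟩ := exists_linearIndependent_namedRow hker hI
    (objective_notMem_span hx hne)
  let e : Fin n ≃ K.insertNone :=
    Fintype.equivOfCardEq (by rw [Fintype.card_coe, Finset.card_insertNone, hK, Fintype.card_fin])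
  have hdet : (Matrix.of fun i => namedRow A α (e i : Option (Fin m))).det ≠ 0 :=
    det_ne_zero_of_linearIndependent (hLI.comp e e.injective)
  obtain ⟨-, h⟩ := borderedMinor_eq_natAbs_det A α (fun o : K.insertNone => (o : Option (Fin m)))
    e (i₀ := ⟨none, Finset.none_mem_insertNone⟩) rfl hdet (K := K) (by simp)
  have hle := borderedMinor_le_Delta_mul (α := α) hI hIK hK
  rw [hΔ, zero_mul, h] at hle
  have h0 : (Matrix.of fun i => namedRow A α (e i : Option (Fin m))).det.natAbs = 0 := by
    exact_mod_cast le_antisymm hle (Nat.cast_nonneg _)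
  exact hdet (Int.natAbs_eq_zero.1 h0)

/-- The bound on `κ_{d + 1}` obtained from a lower bound `v` for the volume of suitable symmetric
bodies in the strip system `|C w| < 1`, where the rows of `C` include the unit vectors and all
maximal minors of `C` are at most one in absolute value. -/
theorem kappa_lt_of_volume_le {m n d : ℕ} {A : Matrix (Fin m) (Fin n) ℤ} {b : Fin m → ℤ}
    {α : Fin n → ℤ} (hb : ∀ i, 0 ≤ b i) (hP : ∀ z : Fin n → ℤ, realVec z ∈ poly A b → z = 0)
    {v : ℝ} (hv : 0 < v)
    (hbody : ∀ (C : Matrix (Fin m) (Fin d) ℝ) (T : Fin d → Fin m),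
      (∀ T' : Fin d → Fin m, |(C.submatrix T' id).det| ≤ 1) → C.submatrix T id = 1 →
      ∃ S : Set (Fin d → ℝ), Convex ℝ S ∧ (∀ w ∈ S, -w ∈ S) ∧
        (∀ w ∈ S, ∀ i, ∑ t, C i t * w t < 1) ∧ ENNReal.ofReal v ≤ volume S) :
    kappa A b α (d + 1) < 2 ^ d / v := by
  have hrec : ∀ y : Fin n → ℝ, (∀ i, (realMatrix A *ᵥ y) i ≤ 0) → y = 0 :=
    fun y hy => eq_zero_of_mulVec_nonpos hb hP hy
  have hker : ∀ y : Fin n → ℝ, realMatrix A *ᵥ y = 0 → y = 0 :=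
    fun y hy => hrec y fun i => by rw [hy]; rfl
  have hc : 0 < 2 ^ d / v := by positivity
  set s := {I : Finset (Fin m) | I.card + 1 ≤ n ∧ RowsIndep A I ∧ affDim (slice A b I) = d + 1}
  rcases (kappaSlice A b α '' s).eq_empty_or_nonempty with h | h
  · rw [kappa, h, Real.sSup_empty]
    exact hc
  obtain ⟨I, ⟨-, hI, hdim⟩, hIκ⟩ := h.csSup_mem (Set.toFinite _)
  rw [kappa, ← hIκ, kappaSlice]
  have hcomp : IsCompact (sliceValues A b α I) := (isCompact_slice hb hrec I).image (by
    unfold dotProduct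
    fun_prop)
  obtain ⟨x, hx, hxs⟩ := hcomp.sSup_mem ⟨_, 0, zero_mem_slice hb I, rfl⟩
  rw [← hxs]
  simp only
  rcases le_or_gt (realVec α ⬝ᵥ x) 0 with hle | hpos
  · exact (div_nonpos_of_nonpos_of_nonneg hle (Delta_nonneg A α I)).trans_lt hc
  obtain ⟨I', hII', hI', hcard, hslice⟩ := exists_rows_cutting_out_slice hb hI
  rw [hdim] at hcard
  obtain ⟨T, e, C, hdet, hcoord, hminors, hCT⟩ := exists_maximal_rowSystem hker hII' hI' hcard
    (objective_notMem_span (hslice x hx) hpos.ne')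
  obtain ⟨S, hconv, hsymm, hS, hvol⟩ := hbody C T hminors hCT
  have hmain := volume_mul_objective_lt hb hP hI T (fun i : ↥(I' \ I) => (i : Fin m)) e hdet hx
    (fun i => hslice x hx i (Finset.mem_sdiff.1 i.2).1) hpos hconv hsymm
    (fun y hyI hyJ hαy hyS i => by
      rw [hcoord y (fun k hk => ?_) hαy i]
      · exact hS _ hyS i
      · by_cases hkI : k ∈ I
        · exact hyI k hkI
        · exact hyJ ⟨k, Finset.mem_sdiff.2 ⟨hk, hkI⟩⟩) hv hvol
  set K : Finset (Fin m) := Finset.univ.filter fun k =>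
    ∃ i, rowName T (fun i : ↥(I' \ I) => (i : Fin m)) I i = some k with hK
  obtain ⟨hKn, hKdet⟩ := borderedMinor_eq_natAbs_det A α
    (rowName T (fun i : ↥(I' \ I) => (i : Fin m)) I) e (i₀ := Sum.inr (Sum.inl none)) rfl hdet
    (K := K) (by simp [hK])
  have hIK : I ⊆ K := fun i hi => by
    rw [hK, Finset.mem_filter]
    exact ⟨Finset.mem_univ _, Sum.inr (Sum.inr ⟨i, hi⟩), rfl⟩
  have hle := borderedMinor_le_Delta_mul (α := α) hI hIK hKn
  rw [hKdet] at hle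
  have hg : (0 : ℝ) < gcdRows A I := by exact_mod_cast Nat.pos_of_ne_zero (gcdRows_ne_zero hI)
  have h1 : v * (realVec α ⬝ᵥ x) < 2 ^ d * Delta A α I := by
    refine lt_of_mul_lt_mul_right (hmain.trans_le ?_) hg.le
    rw [Fintype.card_fin, mul_assoc]
    exact mul_le_mul_of_nonneg_left hle (by positivity)
  have hΔ : 0 < Delta A α I := by
    have h2 : 0 < v * (realVec α ⬝ᵥ x) := mul_pos hv hpos
    exact pos_of_mul_pos_right (h2.trans h1) (by positivity)
  rw [div_lt_div_iff₀ hΔ hv]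
  linarith

end Proximity

theorem theorem4 {m n : ℕ} (A : Matrix (Fin m) (Fin n) ℤ) (b : Fin m → ℤ) (α : Fin n → ℤ)
    (hP : ∀ z : Fin n → ℤ, Proximity.realVec z ∈ Proximity.poly A b ↔ z = 0) :
    (∀ I : Finset (Fin m), I.card + 1 ≤ n → Proximity.RowsIndep A I →
      IsGreatest (Proximity.sliceValues A b α I)
        (Proximity.kappaSlice A b α I * Proximity.Delta A α I)) ∧
    Proximity.kappa A b α 1 < 1 ∧
    Proximity.kappa A b α 2 < 1 ∧
    Proximity.kappa A b α 3 < Real.sqrt 2 := by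
  have hP' : ∀ z : Fin n → ℤ, Proximity.realVec z ∈ Proximity.poly A b → z = 0 :=
    fun z => (hP z).1
  have hb : ∀ i, 0 ≤ b i := by
    intro i
    have h : Proximity.realMatrix A *ᵥ Proximity.realVec 0 ≤ Proximity.realVec b := (hP 0).2 rfl
    rw [Proximity.realMatrix_mulVec_realVec, Matrix.mulVec_zero] at h
    have h2 := h i
    simp only [Proximity.realVec, Pi.zero_apply] at h2
    exact_mod_cast h2
  have hrec : ∀ y : Fin n → ℝ, (∀ i, (Proximity.realMatrix A *ᵥ y) i ≤ 0) → y = 0 :=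
    fun y hy => Proximity.eq_zero_of_mulVec_nonpos hb hP' hy
  refine ⟨fun I _ hI => ?_, ?_, ?_, ?_⟩
  · have hcomp : IsCompact (Proximity.sliceValues A b α I) :=
      (Proximity.isCompact_slice hb hrec I).image (by
        unfold dotProduct
        fun_prop)
    have hgreat := hcomp.isGreatest_sSup ⟨_, 0, Proximity.zero_mem_slice hb I, rfl⟩
    rcases eq_or_ne (Proximity.Delta A α I) 0 with hΔ | hΔ
    · obtain ⟨x, hx, hxs⟩ := hgreat.1
      have h0 := Proximity.objective_eq_zero_of_Delta_eq_zero
        (fun y hy => hrec y fun i => by rw [hy]; rfl) hI hΔ hx.2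
      rw [hΔ, mul_zero, ← h0]
      rw [← hxs] at hgreat
      exact hgreat
    · rwa [Proximity.kappaSlice, div_mul_cancel₀ _ hΔ]
  · have h := Proximity.kappa_lt_of_volume_le (d := 0) (α := α) hb hP' one_pos
      fun C T _ _ => ⟨Set.univ, convex_univ, fun _ _ => Set.mem_univ _, by simp, by
        simp [MeasureTheory.volume_pi]⟩
    simpa using h
  · have h := Proximity.kappa_lt_of_volume_le (d := 1) (α := α) hb hP' two_pos fun C T hC _ => by
      refine ⟨Set.univ.pi fun _ => Set.Ioo (-1) 1, convex_pi fun _ _ => convex_Ioo _ _, ?_, ?_, ?_⟩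
      · intro w hw t _
        have := hw t (Set.mem_univ t)
        exact ⟨neg_lt_neg this.2, by simpa using neg_lt_neg this.1⟩
      · intro w hw i
        have h1 := hw 0 (Set.mem_univ 0)
        have h2 := hC fun _ => i
        simp only [Matrix.det_fin_one, Matrix.submatrix_apply, id] at h2
        simp only [Finset.univ_unique, Fin.default_eq_zero, Fin.isValue, Finset.sum_singleton]
        have h3 : |C i 0 * w 0| < 1 := by
          rw [abs_mul]
          have h4 : |w 0| < 1 := abs_lt.2 h1
          nlinarith [abs_nonneg (C i 0), abs_nonneg (w 0)]
        exact (abs_lt.1 h3).2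
      · rw [MeasureTheory.volume_pi_pi]
        simp only [Real.volume_Ioo, Finset.univ_unique, Finset.prod_const, Finset.card_singleton,
          pow_one]
        norm_num
    simpa using h
  · have h := Proximity.kappa_lt_of_volume_le (d := 2) (α := α) (v := 2 * √2) hb hP'
      (by positivity) fun C T hC hCT => by
      have hT : ∀ s t, C (T s) t = (1 : Matrix (Fin 2) (Fin 2) ℝ) s t :=
        fun s t => congrFun (congrFun hCT s) t
      have hdet : ∀ i j, |C i 0 * C j 1 - C i 1 * C j 0| ≤ 1 := fun i j => by
        have h1 := hC ![i, j]
        rw [Matrix.det_fin_two] at h1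
        exact h1
      refine ⟨Proximity.polarBody (fun i => C i 0) fun i => C i 1,
        Proximity.convex_polarBody _ _, fun _ => Proximity.neg_mem_polarBody, ?_, ?_⟩
      · intro w hw i
        rw [Fin.sum_univ_two]
        exact (abs_lt.1 (hw i)).2
      · refine Proximity.two_sqrt_two_le_volume_polarBody (fun i => ?_) (fun i => ?_) fun i j => ?_
        · simpa [hT] using hdet i (T 1)
        · simpa [hT] using hdet (T 0) i
        · rw [mul_comm (C j 0)]
          exact hdet i j
    have h2 : (2 : ℝ) ^ 2 / (2 * √2) = √2 := by
      have h3 : √2 * √2 = 2 := Real.mul_self_sqrt (by norm_num)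
      have h4 : √2 ≠ 0 := by positivity
      field_simp
      linarith
    rwa [h2] at h
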